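/- Let $\Gamma=\mathrm{SL}_2(\mathbb{Z})$. For an even integer $k$ let $S_k(\Gamma)$ be the space of holomorphic cusp forms of weight $k$ for $\Gamma$, with the Petersson inner product $\langle f,g\rangle=\int_{\Gamma\backslash\mathbb{H}}\overline{f(z)}\,g(z)\,y^k\,\frac{dx\,dy}{y^2}$ (the measure $dx\,dy/y^2$ not normalized). For an orthonormal basis $\mathcal{B}_k$ of $S_k(\Gamma)$ and a real number $x$, let $\mu_k^\times$ be the measure on $\mathbb{R}^+=(0,\infty)$ given by $$d\mu_k^\times=\frac{1}{|\mathcal{B}_k|}\sum_{f\in\mathcal{B}_k}y^k|f(x+iy)|^2\,\frac{dy}{y}.$$ There are absolute positive constants $A_0,Y_0,k_0,C$ such that the following holds for all real $A\ge A_0$ and $Y\ge Y_0$, all even integers $k\ge k_0$, every orthonormal basis $\mathcal{B}_k$ of $S_k(\Gamma)$, and every $x\in\mathbb{R}$. If $\psi:\mathbb{R}^+\to\mathbb{C}$ is smooth and compactly supported with $$\operatorname{supp}\psi\subset\bigl(Y^{-1},\,k^{1/2}(17A\log k)^{-1/2}\bigr),$$ then $$\left|\int_{\mathbb{R}^+}\psi(y)\,d\mu_k^\times(y)-\frac{3}{\pi}\int_{\mathbb{R}^+}\psi(y)\,\frac{dy}{y}\right|\le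 C\,\|\psi\|_\infty\,Y^2\,k^{-1/2}(\log k)^{1/2}.$$ -/

import Mathlib

open scoped MatrixGroups ContDiff

noncomputable section

/-- The Petersson inner product `∫_{SL(2,ℤ)\ℍ} conj (f z) g z y^k dx dy / y²` on cusp forms of
weight `k` for `SL(2,ℤ)`. It is an integral over the standard fundamental domain, and
`MeasureTheory.volume` on the upper half-plane is the hyperbolic measure `dx dy / y²`
(not normalized: the fundamental domain has volume `π / 3`). -/
def peterssonInner (k : ℕ) (f g : CuspForm 𝒮ℒ (k : ℤ)) : ℂ :=
  ∫ z in ModularGroup.fd, UpperHalfPlane.petersson (k : ℤ) f g z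

/-- A basis of the space of cusp forms of weight `k` for `SL(2,ℤ)` that is orthonormal for the
Petersson inner product. -/
def IsPeterssonOrthonormal {k : ℕ} {ι : Type*}
    (B : Module.Basis ι ℂ (CuspForm 𝒮ℒ (k : ℤ))) : Prop :=
  (∀ i, peterssonInner k (B i) (B i) = 1) ∧
    ∀ i j, i ≠ j → peterssonInner k (B i) (B j) = 0

/-- The density `|B|⁻¹ ∑_{f ∈ B} y^k |f(x + iy)|²`, meaningful for `y > 0`. -/
def averagedDensity {k : ℕ} {ι : Type*} [Fintype ι]
    (B : Module.Basis ι ℂ (CuspForm 𝒮ℒ (k : ℤ))) (x y : ℝ) : ℝ :=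
  (Fintype.card ι : ℝ)⁻¹ *
    ∑ i, y ^ k * ‖B i (UpperHalfPlane.ofComplex ((x : ℂ) + (y : ℂ) * Complex.I))‖ ^ 2

/-- The measure `dy / y` on `(0, ∞)`, as a measure on `ℝ`. -/
def multiplicativeMeasure : MeasureTheory.Measure ℝ :=
  (MeasureTheory.volume.restrict (Set.Ioi (0 : ℝ))).withDensity fun y => ENNReal.ofReal (1 / y)

/-- The averaged measure `|B|⁻¹ ∑_{f ∈ B} y^k |f(x + iy)|² dy / y` on the vertical geodesic over
`x`, as a measure on `ℝ` carried by `(0, ∞)`. -/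
def averagedVerticalMeasure {k : ℕ} {ι : Type*} [Fintype ι]
    (B : Module.Basis ι ℂ (CuspForm 𝒮ℒ (k : ℤ))) (x : ℝ) : MeasureTheory.Measure ℝ :=
  multiplicativeMeasure.withDensity fun y => ENNReal.ofReal (averagedDensity B x y)

end

/-!
The normalised kernel `(2i / (z - conj w))^k` reproduces holomorphic functions of weight `k` on `ℍ`:
in the disc centred at `w` this is the mean value property. Unfolding its Poincaré series against
an orthonormal basis of cusp forms gives the pretrace formula
`∑ f, y^k |f(x + iy)|² = (k - 1) / (8π) * ∑ g, (…)^k`, whose `g`-th term has modulus `u_g^(-k/2)`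
with `u_g = cosh² (d(z, gz) / 2)`, `z = x + iy`. The terms `g = ±1` contribute `2`, and after
division by `dim S_k = k / 12 + O(1)` they become the main term `3 / π`.

The remaining terms are integrated over `y` before they are summed. Along the vertical line, a
matrix with lower left entry `c ≠ 0` brings `x + iy` close to itself only in a short window of `y`;
since `1 / y ≤ Y`, the integral of `u_g^(-k/2) dy / y` is thus at most `Y² / √k` times a factor that
is summable over `g`, uniformly in `x`. When `c = 0`, `g` is the translation
by some `n` and `u_g = 1 + n² / (4y²)`; then `y² ≤ k / (24 log k)` makes `u_g^(-k/2)` smaller than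
a fixed negative power of `k`.
-/

section

open MeasureTheory Set Metric
open UpperHalfPlane (upperHalfPlaneSet petersson ofComplex verticalStrip)
open EisensteinSeries (r)
open scoped ComplexConjugate UpperHalfPlane Modular ModularForm Manifold ENNReal NNReal

section RadialMeanValue

variable {E : Type*} [NormedAddCommGroup E]

theorem integrableOn_comp_complexPolarCoord_symm [NormedSpace ℝ E] {G : ℂ → E}
    (hG : Integrable G) :
    IntegrableOn (fun p : ℝ × ℝ ↦ p.1 • G (Complex.polarCoord.symm p)) polarCoord.target := by
  have hG' : Integrable fun p : ℝ × ℝ ↦ G (Complex.measurableEquivRealProd.symm p) :=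
    Complex.volume_preserving_equiv_real_prod.symm.integrable_comp_of_integrable hG
  have h := (integrableOn_image_iff_integrableOn_abs_det_fderiv_smul volume
    polarCoord.open_target.measurableSet
    (fun p _ ↦ (hasFDerivAt_polarCoord_symm p).hasFDerivWithinAt)
    polarCoord.symm.injOn _).mp hG'.integrableOn
  refine h.congr_fun (fun p hp ↦ ?_) polarCoord.open_target.measurableSet
  simp only [det_fderivPolarCoordSymm, abs_of_pos (show 0 < p.1 from hp.1),
    Complex.measurableEquivRealProd_symm_polarCoord_symm_apply]

variable [NormedSpace ℂ E] [CompleteSpace E]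

theorem integral_polarCoord_symm_eq_of_diffContOnCl {F : ℂ → E} {r : ℝ}
    (hF : DiffContOnCl ℂ F (ball 0 |r|)) :
    ∫ θ in Ioo (-Real.pi) Real.pi, F (Complex.polarCoord.symm (r, θ)) =
      (2 * Real.pi) • F 0 := by
  have h : (2 * Real.pi)⁻¹ • ∫ θ in (-Real.pi)..Real.pi, F (circleMap 0 r θ) = F 0 := by
    have h := hF.circleAverage
    rwa [Real.circleAverage_eq_integral_add (-Real.pi),
      intervalIntegral.integral_comp_add_right (fun θ ↦ F (circleMap 0 r θ)), zero_add,
      two_mul, add_neg_cancel_right, ← two_mul] at h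
  have hpolar : ∀ θ : ℝ, Complex.polarCoord.symm (r, θ) = circleMap 0 r θ := fun θ ↦ by
    simp [circleMap, Complex.exp_mul_I]
  simp only [hpolar]
  rw [← h, smul_inv_smul₀ (by positivity), ← integral_Ioc_eq_integral_Ioo,
    ← intervalIntegral.integral_of_le (by linarith [Real.pi_pos])]

theorem integral_ball_radial_smul {F : ℂ → E} {R : ℝ} (hF : DifferentiableOn ℂ F (ball 0 R))
    {φ : ℝ → ℝ} (hinteg : IntegrableOn (fun ζ ↦ φ ‖ζ‖ • F ζ) (ball 0 R)) :
    ∫ ζ in ball (0 : ℂ) R, φ ‖ζ‖ • F ζ =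
      (2 * Real.pi * ∫ r in Ioo 0 R, r * φ r) • F 0 := by
  set G : ℂ → E := (ball (0 : ℂ) R).indicator fun ζ ↦ φ ‖ζ‖ • F ζ with hG
  have hcircle : ∀ r ∈ Ioi (0 : ℝ),
      ∫ θ in Ioo (-Real.pi) Real.pi, r • G (Complex.polarCoord.symm (r, θ)) =
        (Iio R).indicator (fun r ↦ (r * φ r) • (2 * Real.pi) • F 0) r := by
    intro r (hr : 0 < r)
    have hnorm : ∀ θ : ℝ, ‖Complex.polarCoord.symm (r, θ)‖ = r := fun θ ↦ by
      rw [Complex.norm_polarCoord_symm, abs_of_pos hr]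
    by_cases hrR : r < R
    · have hd : DiffContOnCl ℂ F (ball 0 |r|) := by
        refine (hF.mono ?_).diffContOnCl
        rw [abs_of_pos hr, closure_ball _ hr.ne']
        exact closedBall_subset_ball hrR
      simp only [hG, indicator, mem_ball_zero_iff, hnorm, mem_Iio, hrR, if_true]
      simp only [smul_smul]
      rw [integral_smul, integral_polarCoord_symm_eq_of_diffContOnCl hd, smul_smul]
    · simp only [hG, indicator, mem_ball_zero_iff, hnorm, mem_Iio, hrR, if_false, smul_zero,
        integral_zero]
  have hpolar := integrableOn_comp_complexPolarCoord_symm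
    ((integrable_indicator_iff measurableSet_ball).mpr hinteg)
  rw [← integral_indicator measurableSet_ball, ← Complex.integral_comp_polarCoord_symm]
  rw [polarCoord_target, Measure.volume_eq_prod] at hpolar ⊢
  rw [setIntegral_prod _ hpolar, setIntegral_congr_fun measurableSet_Ioi hcircle,
    setIntegral_indicator measurableSet_Iio, Ioi_inter_Iio, integral_smul_const, smul_smul,
    mul_comm]

end RadialMeanValue

theorem integral_mul_one_sub_sq_pow (n : ℕ) :
    ∫ r in Ioo (0 : ℝ) 1, r * (1 - r ^ 2) ^ n = 1 / (2 * ((n : ℝ) + 1)) := by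
  have hderiv : ∀ r ∈ uIcc (0 : ℝ) 1,
      HasDerivAt (fun r : ℝ ↦ -(1 - r ^ 2) ^ (n + 1) / (2 * (n + 1))) (r * (1 - r ^ 2) ^ n) r := by
    intro r _
    refine (((((hasDerivAt_id' r).pow 2).const_sub 1).pow (n + 1)).neg.div_const
      (2 * ((n : ℝ) + 1))).congr_deriv ?_
    have : (n : ℝ) + 1 ≠ 0 := by positivity
    push_cast
    field_simp
    simp [mul_comm]
  rw [← integral_Ioc_eq_integral_Ioo, ← intervalIntegral.integral_of_le zero_le_one,
    intervalIntegral.integral_eq_sub_of_hasDerivAt hderiv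
      (Continuous.intervalIntegrable (by fun_prop) _ _)]
  simp [neg_div]

section DiscModel

/-- The Cayley map from the unit disc to the upper half-plane sending `0` to `w`. It transports
the reproducing property of the Bergman kernel from the mean value property on the disc. -/
noncomputable def discToHalfPlane (w ζ : ℂ) : ℂ := (w - conj w * ζ) / (1 - ζ)

variable {w ζ : ℂ}

theorem one_sub_ne_zero_of_mem_ball (hζ : ζ ∈ ball (0 : ℂ) 1) : 1 - ζ ≠ 0 := by
  rintro h
  simp [← sub_eq_zero.mp h] at hζ

theorem one_sub_norm_sq_pos_of_mem_ball (hζ : ζ ∈ ball (0 : ℂ) 1) : 0 < 1 - ‖ζ‖ ^ 2 := by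
  rw [mem_ball_zero_iff] at hζ
  nlinarith [norm_nonneg ζ]

theorem sub_conj_eq_two_mul_I_mul_im (w : ℂ) : w - conj w = 2 * Complex.I * w.im := by
  rw [Complex.sub_conj]
  push_cast
  ring

theorem discToHalfPlane_zero (w : ℂ) : discToHalfPlane w 0 = w := by
  simp [discToHalfPlane]

theorem discToHalfPlane_sub_conj (w : ℂ) (hζ : ζ ∈ ball (0 : ℂ) 1) :
    discToHalfPlane w ζ - conj w = 2 * Complex.I * w.im / (1 - ζ) := by
  have := one_sub_ne_zero_of_mem_ball hζ
  rw [← sub_conj_eq_two_mul_I_mul_im, discToHalfPlane]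
  field_simp
  ring

theorem discToHalfPlane_im (w : ℂ) (hζ : ζ ∈ ball (0 : ℂ) 1) :
    (discToHalfPlane w ζ).im = w.im * (1 - ‖ζ‖ ^ 2) / ‖1 - ζ‖ ^ 2 := by
  have : Complex.normSq (1 - ζ) ≠ 0 := by simpa using one_sub_ne_zero_of_mem_ball hζ
  rw [discToHalfPlane, Complex.div_im, ← Complex.normSq_eq_norm_sq, ← Complex.normSq_eq_norm_sq]
  field_simp
  simp only [Complex.normSq_apply, Complex.sub_re, Complex.sub_im, Complex.mul_re, Complex.mul_im,
    Complex.conj_re, Complex.conj_im, Complex.one_re, Complex.one_im]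
  ring

theorem discToHalfPlane_im_pos (hw : 0 < w.im) (hζ : ζ ∈ ball (0 : ℂ) 1) :
    0 < (discToHalfPlane w ζ).im := by
  rw [discToHalfPlane_im w hζ]
  have := one_sub_ne_zero_of_mem_ball hζ
  have := one_sub_norm_sq_pos_of_mem_ball hζ
  positivity

theorem hasDerivAt_discToHalfPlane (w : ℂ) (hζ : ζ ∈ ball (0 : ℂ) 1) :
    HasDerivAt (discToHalfPlane w) (2 * Complex.I * w.im / (1 - ζ) ^ 2) ζ := by
  refine ((((hasDerivAt_id' ζ).const_mul (conj w)).const_sub w).div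
    ((hasDerivAt_id' ζ).const_sub 1) (one_sub_ne_zero_of_mem_ball hζ)).congr_deriv ?_
  rw [← sub_conj_eq_two_mul_I_mul_im]
  congr 1
  ring

theorem injOn_discToHalfPlane (hw : 0 < w.im) : InjOn (discToHalfPlane w) (ball 0 1) := by
  intro a ha b hb hab
  have hw' : (2 * Complex.I * w.im : ℂ) ≠ 0 := by simp [hw.ne']
  have h : 2 * Complex.I * w.im / (1 - a) = 2 * Complex.I * w.im / (1 - b) := by
    rw [← discToHalfPlane_sub_conj w ha, ← discToHalfPlane_sub_conj w hb, hab]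
  rw [div_eq_div_iff (one_sub_ne_zero_of_mem_ball ha) (one_sub_ne_zero_of_mem_ball hb)] at h
  linear_combination mul_left_cancel₀ hw' h

theorem norm_sub_lt_norm_sub_conj {z : ℂ} (hw : 0 < w.im) (hz : 0 < z.im) :
    ‖z - w‖ < ‖z - conj w‖ := by
  refine lt_of_pow_lt_pow_left₀ 2 (norm_nonneg _) ?_
  simp only [← Complex.normSq_eq_norm_sq, Complex.normSq_apply, Complex.sub_re, Complex.sub_im,
    Complex.conj_re, Complex.conj_im]
  nlinarith [mul_pos hw hz]

theorem discToHalfPlane_image_ball (hw : 0 < w.im) :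
    discToHalfPlane w '' ball 0 1 = upperHalfPlaneSet := by
  refine Subset.antisymm ?_ fun z hz ↦ ?_
  · rintro _ ⟨ζ, hζ, rfl⟩
    exact discToHalfPlane_im_pos hw hζ
  · have hlt := norm_sub_lt_norm_sub_conj hw hz
    have h0 : z - conj w ≠ 0 := norm_pos_iff.mp ((norm_nonneg _).trans_lt hlt)
    have hζ : (z - w) / (z - conj w) ∈ ball (0 : ℂ) 1 := by
      rwa [mem_ball_zero_iff, norm_div, div_lt_one (norm_pos_iff.mpr h0)]
    refine ⟨_, hζ, ?_⟩
    rw [discToHalfPlane, div_eq_iff (one_sub_ne_zero_of_mem_ball hζ)]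
    field_simp
    ring

theorem abs_det_restrictScalars_toSpanSingleton (a : ℂ) :
    |((ContinuousLinearMap.toSpanSingleton ℂ a).restrictScalars ℝ).det| = ‖a‖ ^ 2 := by
  rw [ContinuousLinearMap.det, ContinuousLinearMap.coe_restrictScalars,
    LinearMap.det_restrictScalars]
  simp [Algebra.norm_complex_eq, Complex.normSq_eq_norm_sq]

theorem hasFDerivWithinAt_discToHalfPlane (w : ℂ) (hζ : ζ ∈ ball (0 : ℂ) 1) :
    HasFDerivWithinAt (discToHalfPlane w)
      ((ContinuousLinearMap.toSpanSingleton ℂ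
        (2 * Complex.I * w.im / (1 - ζ) ^ 2 : ℂ)).restrictScalars ℝ) (ball 0 1) ζ :=
  ((hasDerivAt_discToHalfPlane w hζ).hasFDerivAt.restrictScalars ℝ).hasFDerivWithinAt

end DiscModel

section BergmanReproducing

variable {w : ℂ} {n : ℕ} {f : ℂ → ℂ}

/-- The weight `n + 2` Bergman kernel at `w`, conjugated, times `f z` and the weight `y ^ n`: the
integrand of the reproducing formula on the upper half-plane. The exponent of `y` already accounts
for the hyperbolic measure `dx dy / y ^ 2`. -/
noncomputable def bergmanIntegrand (n : ℕ) (f : ℂ → ℂ) (w z : ℂ) : ℂ :=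
  conj ((2 * Complex.I / (z - conj w)) ^ (n + 2)) * f z * (z.im : ℂ) ^ n

theorem jacobian_smul_bergmanIntegrand (hw : 0 < w.im) (n : ℕ) (f : ℂ → ℂ)
    {ζ : ℂ} (hζ : ζ ∈ ball (0 : ℂ) 1) :
    ‖2 * Complex.I * w.im / (1 - ζ) ^ 2‖ ^ 2 • bergmanIntegrand n f w (discToHalfPlane w ζ) =
      (4 : ℂ) • ((1 - ‖ζ‖ ^ 2) ^ n • (f (discToHalfPlane w ζ) / (1 - ζ) ^ (n + 2))) := by
  have h0 := one_sub_ne_zero_of_mem_ball hζ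
  have hw0 : (w.im : ℂ) ≠ 0 := by exact_mod_cast hw.ne'
  have hconj : conj (1 - ζ) ≠ 0 := (map_ne_zero _).mpr h0
  have hkernel : 2 * Complex.I / (discToHalfPlane w ζ - conj w) = (1 - ζ) / w.im := by
    rw [discToHalfPlane_sub_conj w hζ]
    field_simp
  have hjacobian : ‖2 * Complex.I * w.im / (1 - ζ) ^ 2‖ ^ 2 =
      4 * w.im ^ 2 / (‖1 - ζ‖ ^ 2) ^ 2 := by
    simp only [norm_div, norm_mul, norm_pow, Complex.norm_ofNat, Complex.norm_I, Complex.norm_real,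
      Real.norm_eq_abs, mul_one, div_pow, mul_pow, sq_abs]
    ring
  have hnorm : ((‖1 - ζ‖ ^ 2 : ℝ) : ℂ) = (1 - ζ) * conj (1 - ζ) := by
    rw [Complex.mul_conj, Complex.normSq_eq_norm_sq]
  rw [bergmanIntegrand, hkernel, hjacobian, discToHalfPlane_im w hζ, Complex.real_smul,
    Complex.real_smul, map_pow, map_div₀, Complex.conj_ofReal, Complex.ofReal_div,
    Complex.ofReal_div, Complex.ofReal_pow, hnorm, smul_eq_mul]
  push_cast
  rw [div_pow, div_pow, mul_pow, mul_pow, mul_pow]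
  field_simp
  ring

theorem integrableOn_bergmanIntegrand_iff (hw : 0 < w.im) :
    IntegrableOn (bergmanIntegrand n f w) upperHalfPlaneSet ↔
      IntegrableOn (fun ζ ↦ (1 - ‖ζ‖ ^ 2) ^ n • (f (discToHalfPlane w ζ) / (1 - ζ) ^ (n + 2)))
        (ball (0 : ℂ) 1) := by
  rw [← discToHalfPlane_image_ball hw, integrableOn_image_iff_integrableOn_abs_det_fderiv_smul
    volume measurableSet_ball (fun ζ hζ ↦ hasFDerivWithinAt_discToHalfPlane w hζ)
    (injOn_discToHalfPlane hw)]
  simp only [abs_det_restrictScalars_toSpanSingleton]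
  rw [integrableOn_congr_fun (fun ζ hζ ↦ jacobian_smul_bergmanIntegrand hw n f hζ)
    measurableSet_ball]
  exact integrable_smul_iff (by norm_num : (4 : ℂ) ≠ 0) _

theorem setIntegral_bergmanIntegrand_eq (hw : 0 < w.im) :
    ∫ z in upperHalfPlaneSet, bergmanIntegrand n f w z =
      (4 : ℂ) • ∫ ζ in ball (0 : ℂ) 1,
        (1 - ‖ζ‖ ^ 2) ^ n • (f (discToHalfPlane w ζ) / (1 - ζ) ^ (n + 2)) := by
  rw [← discToHalfPlane_image_ball hw, integral_image_eq_integral_abs_det_fderiv_smul volume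
    measurableSet_ball (fun ζ hζ ↦ hasFDerivWithinAt_discToHalfPlane w hζ)
    (injOn_discToHalfPlane hw), ← integral_smul]
  simp only [abs_det_restrictScalars_toSpanSingleton]
  exact setIntegral_congr_fun measurableSet_ball
    fun ζ hζ ↦ jacobian_smul_bergmanIntegrand hw n f hζ

theorem differentiableOn_comp_discToHalfPlane_div (hw : 0 < w.im)
    (hf : DifferentiableOn ℂ f upperHalfPlaneSet) (n : ℕ) :
    DifferentiableOn ℂ (fun ζ ↦ f (discToHalfPlane w ζ) / (1 - ζ) ^ n) (ball 0 1) := by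
  refine DifferentiableOn.div ?_ (by fun_prop)
    fun ζ hζ ↦ pow_ne_zero _ (one_sub_ne_zero_of_mem_ball hζ)
  exact hf.comp (fun ζ hζ ↦ (hasDerivAt_discToHalfPlane w hζ).differentiableAt
    |>.differentiableWithinAt) fun ζ hζ ↦ discToHalfPlane_im_pos hw hζ

theorem norm_one_sub_sq_pow_smul_comp_discToHalfPlane_le (hw : 0 < w.im) (hn : 2 ≤ n) {M : ℝ}
    (hM : ∀ z ∈ upperHalfPlaneSet, ‖f z‖ ^ 2 * z.im ^ (n + 2) ≤ M)
    {ζ : ℂ} (hζ : ζ ∈ ball (0 : ℂ) 1) :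
    ‖(1 - ‖ζ‖ ^ 2) ^ n • (f (discToHalfPlane w ζ) / (1 - ζ) ^ (n + 2))‖ ≤
      Real.sqrt (M / w.im ^ (n + 2)) := by
  obtain ⟨m, rfl⟩ := Nat.exists_eq_add_of_le hn
  have h1 := one_sub_norm_sq_pos_of_mem_ball hζ
  have hζ1 : 0 < ‖1 - ζ‖ := norm_pos_iff.mpr (one_sub_ne_zero_of_mem_ball hζ)
  have hsq : ‖(1 - ‖ζ‖ ^ 2) ^ (2 + m) • (f (discToHalfPlane w ζ) / (1 - ζ) ^ (2 + m + 2))‖ ^ 2 *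
      w.im ^ (2 + m + 2) = ‖f (discToHalfPlane w ζ)‖ ^ 2 *
        (discToHalfPlane w ζ).im ^ (2 + m + 2) * (1 - ‖ζ‖ ^ 2) ^ m := by
    rw [discToHalfPlane_im w hζ, norm_smul, norm_div, norm_pow, norm_pow,
      Real.norm_of_nonneg h1.le]
    generalize 1 - ‖ζ‖ ^ 2 = s
    rw [div_pow (w.im * s), mul_pow w.im s]
    field_simp
    ring
  refine Real.le_sqrt_of_sq_le ?_
  rw [le_div_iff₀ (by positivity), hsq]
  refine (mul_le_of_le_one_right ?_ (pow_le_one₀ h1.le (sub_le_self _ (sq_nonneg _)))).trans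
    (hM _ (discToHalfPlane_im_pos hw hζ))
  have := discToHalfPlane_im_pos hw hζ
  positivity

theorem integrableOn_bergmanIntegrand (hw : 0 < w.im) (hn : 2 ≤ n)
    (hf : DifferentiableOn ℂ f upperHalfPlaneSet) {M : ℝ}
    (hM : ∀ z ∈ upperHalfPlaneSet, ‖f z‖ ^ 2 * z.im ^ (n + 2) ≤ M) :
    IntegrableOn (bergmanIntegrand n f w) upperHalfPlaneSet := by
  rw [integrableOn_bergmanIntegrand_iff hw]
  refine IntegrableOn.of_bound measure_ball_lt_top ?_ (Real.sqrt (M / w.im ^ (n + 2)))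
    ((ae_restrict_iff' measurableSet_ball).mpr (ae_of_all _ fun ζ hζ ↦
      norm_one_sub_sq_pow_smul_comp_discToHalfPlane_le hw hn hM hζ))
  have hcont : ContinuousOn (fun ζ : ℂ ↦ (1 - ‖ζ‖ ^ 2) ^ n) (ball 0 1) := by fun_prop
  exact (hcont.smul (differentiableOn_comp_discToHalfPlane_div hw hf (n + 2)).continuousOn)
    |>.aestronglyMeasurable measurableSet_ball

theorem setIntegral_bergmanIntegrand (hw : 0 < w.im) (hn : 2 ≤ n)
    (hf : DifferentiableOn ℂ f upperHalfPlaneSet) {M : ℝ}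
    (hM : ∀ z ∈ upperHalfPlaneSet, ‖f z‖ ^ 2 * z.im ^ (n + 2) ≤ M) :
    ∫ z in upperHalfPlaneSet, bergmanIntegrand n f w z = 4 * Real.pi / (n + 1) * f w := by
  have hinteg := integrableOn_bergmanIntegrand hw hn hf hM
  rw [integrableOn_bergmanIntegrand_iff hw] at hinteg
  rw [setIntegral_bergmanIntegrand_eq hw, integral_ball_radial_smul (φ := fun r ↦ (1 - r ^ 2) ^ n)
    (differentiableOn_comp_discToHalfPlane_div hw hf (n + 2)) hinteg, integral_mul_one_sub_sq_pow,
    discToHalfPlane_zero, Complex.real_smul, smul_eq_mul]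
  have : (n : ℂ) + 1 ≠ 0 := by exact_mod_cast n.succ_ne_zero
  push_cast
  field_simp
  simp

end BergmanReproducing

section HyperbolicMeasure

variable {E : Type*} [NormedAddCommGroup E] [NormedSpace ℝ E]

theorem integral_upperHalfPlane_eq_setIntegral (g : ℂ → E) :
    ∫ τ : ℍ, g τ = ∫ z in upperHalfPlaneSet, ((1 / z.im) ^ 2 : ℝ) • g z := by
  rw [UpperHalfPlane.volume_def, integral_withDensity_eq_integral_smul (by fun_prop),
    ← UpperHalfPlane.range_coe, ← UpperHalfPlane.measurableEmbedding_coe.map_comap,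
    UpperHalfPlane.measurableEmbedding_coe.integral_map]
  rfl

theorem integrable_upperHalfPlane_iff_integrableOn (g : ℂ → E) :
    Integrable (fun τ : ℍ ↦ g τ) ↔
      IntegrableOn (fun z ↦ ((1 / z.im) ^ 2 : ℝ) • g z) upperHalfPlaneSet := by
  rw [UpperHalfPlane.volume_def, integrable_withDensity_iff_integrable_smul (by fun_prop),
    IntegrableOn, ← UpperHalfPlane.range_coe, ← UpperHalfPlane.measurableEmbedding_coe.map_comap,
    UpperHalfPlane.measurableEmbedding_coe.integrable_map_iff]
  rfl

end HyperbolicMeasure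

section Unfolding

variable {G α : Type*} [Group G] [Countable G] [MulAction G α] [MeasurableSpace α]
  [MeasurableConstSMul G α] {μ : Measure α} [SMulInvariantMeasure G α μ] {s : Set α} {N : ℝ≥0∞}

theorem sum_map_smul_restrict_eq_smul (hs : MeasurableSet s)
    (hN : ∀ᵐ z ∂μ, ∑' g : G, s.indicator (1 : α → ℝ≥0∞) (g⁻¹ • z) = N) :
    Measure.sum (fun g : G ↦ (μ.restrict s).map (g • ·)) = N • μ := by
  ext t ht
  have hmap : ∀ g : G, (μ.restrict s).map (g • ·) t =
      ∫⁻ z in t, s.indicator (1 : α → ℝ≥0∞) (g⁻¹ • z) ∂μ := by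
    intro g
    have hpre : (g⁻¹ • · : α → α) ⁻¹' ((g • · : α → α) ⁻¹' t ∩ s) =
        (g⁻¹ • · : α → α) ⁻¹' s ∩ t := by
      ext z
      simp [and_comm]
    rw [Measure.map_apply (measurable_const_smul g) ht,
      Measure.restrict_apply (measurable_const_smul g ht), ← measure_preimage_smul μ g⁻¹, hpre,
      ← Measure.restrict_apply (measurable_const_smul g⁻¹ hs),
      ← lintegral_indicator_one (measurable_const_smul g⁻¹ hs)]
    rfl
  have hmeas : ∀ g : G, Measurable fun z ↦ s.indicator (1 : α → ℝ≥0∞) (g⁻¹ • z) := fun g ↦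
    (measurable_one.indicator hs).comp (measurable_const_smul g⁻¹)
  rw [Measure.sum_apply _ ht]
  simp only [hmap]
  rw [← lintegral_tsum fun g ↦ (hmeas g).aemeasurable,
    lintegral_congr_ae (ae_restrict_of_ae hN), setLIntegral_const, Measure.smul_apply, smul_eq_mul]

variable {E : Type*} [NormedAddCommGroup E] [NormedSpace ℝ E] {φ : α → E}

theorem hasSum_setIntegral_smul (hs : MeasurableSet s) (hN' : N ≠ ⊤)
    (hN : ∀ᵐ z ∂μ, ∑' g : G, s.indicator (1 : α → ℝ≥0∞) (g⁻¹ • z) = N) (hφ : Integrable φ μ) :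
    HasSum (fun g : G ↦ ∫ z in s, φ (g • z) ∂μ) (N.toReal • ∫ z, φ z ∂μ) := by
  have hmeasure := sum_map_smul_restrict_eq_smul hs hN
  have h := hasSum_integral_measure (hmeasure ▸ hφ.smul_measure hN')
  simpa only [hmeasure, integral_smul_measure,
    (measurableEmbedding_const_smul _).integral_map] using h

theorem setIntegral_tsum_smul [CompleteSpace E] (hs : MeasurableSet s) (hN' : N ≠ ⊤)
    (hN : ∀ᵐ z ∂μ, ∑' g : G, s.indicator (1 : α → ℝ≥0∞) (g⁻¹ • z) = N) (hφ : Integrable φ μ) :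
    ∫ z in s, ∑' g : G, φ (g • z) ∂μ = N.toReal • ∫ z, φ z ∂μ :=
  (hasSum_integral_of_summable_integral_norm
    (fun g ↦ ((measurePreserving_smul g μ).integrable_comp_of_integrable hφ).integrableOn)
    (hasSum_setIntegral_smul hs hN' hN hφ.norm).summable).unique
      (hasSum_setIntegral_smul hs hN' hN hφ)

end Unfolding

section ModularGroupAction

open ModularGroup (fd fdo)

instance countable_specialLinearGroup_int : Countable SL(2, ℤ) := by
  have : Countable (Matrix (Fin 2) (Fin 2) ℤ) := inferInstanceAs (Countable (Fin 2 → Fin 2 → ℤ))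
  exact Subtype.countable

theorem continuous_specialLinearGroup_smul (g : SL(2, ℤ)) : Continuous fun z : ℍ ↦ g • z :=
  continuous_const_smul (g : GL (Fin 2) ℝ)

instance measurableConstSMul_upperHalfPlane : MeasurableConstSMul SL(2, ℤ) ℍ :=
  ⟨fun g ↦ (continuous_specialLinearGroup_smul g).measurable⟩

instance smulInvariantMeasure_upperHalfPlane : SMulInvariantMeasure SL(2, ℤ) ℍ volume :=
  ⟨fun g s _ ↦ measure_preimage_smul (volume : Measure ℍ) (g : GL (Fin 2) ℝ) s⟩

theorem measurableSet_fd : MeasurableSet 𝒟 := ModularGroup.isClosed_fd.measurableSet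

theorem volume_fd_diff_fdo : volume (𝒟 \ 𝒟ᵒ) = 0 := by
  have hsubset : ((↑) : ℍ → ℂ) '' (𝒟 \ 𝒟ᵒ) ⊆ sphere 0 1 ∪
      (frontier {z : ℂ | z.re ≤ 1 / 2} ∪ frontier {z : ℂ | -(1 / 2) ≤ z.re}) := by
    rintro _ ⟨z, ⟨⟨hnorm, hre⟩, hz⟩, rfl⟩
    rw [Complex.frontier_setOfPred_re_le, Complex.frontier_setOfPred_le_re]
    by_contra hboundary
    simp only [mem_union, not_or, mem_sphere_iff_norm, sub_zero, mem_ofPred_eq] at hboundary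
    obtain ⟨hnorm_ne, hre_ne, hre_ne'⟩ := hboundary
    refine hz ⟨lt_of_le_of_ne hnorm fun h ↦ hnorm_ne ?_, lt_of_le_of_ne hre fun h ↦ ?_⟩
    · rw [Complex.normSq_eq_norm_sq] at h
      exact (pow_eq_one_iff_of_nonneg (norm_nonneg _) two_ne_zero).mp h.symm
    · exact (eq_or_eq_neg_of_abs_eq h).elim hre_ne hre_ne'
  rw [UpperHalfPlane.volume_eq_lintegral]
  refine setLIntegral_measure_zero _ _ (measure_mono_null hsubset ?_)
  rw [measure_union_null_iff, measure_union_null_iff]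
  exact ⟨Measure.addHaar_sphere _ _ _, (convex_halfSpace_re_le _).addHaar_frontier _,
    (convex_halfSpace_re_ge _).addHaar_frontier _⟩

theorem ae_smul_notMem_fd_diff_fdo : ∀ᵐ z : ℍ, ∀ g : SL(2, ℤ), g • z ∉ 𝒟 \ 𝒟ᵒ :=
  ae_all_iff.mpr fun g ↦ measure_eq_zero_iff_ae_notMem.mp
    ((measurePreserving_smul g volume).quasiMeasurePreserving.preimage_null volume_fd_diff_fdo)

theorem smul_mem_fd_iff_of_mem_fdo {z : ℍ} (hz : z ∈ 𝒟ᵒ) {g : SL(2, ℤ)} :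
    g • z ∈ 𝒟 ↔ g = 1 ∨ g = -1 := by
  refine ⟨ModularGroup.eq_one_or_neg_one_of_mem_fdo_mem_fd hz, ?_⟩
  have hz' := ModularGroup.fdo_subset_fd hz
  rintro (rfl | rfl) <;> simpa using hz'

theorem ae_tsum_indicator_fd_smul : ∀ᵐ z : ℍ, ∑' g : SL(2, ℤ),
    fd.indicator (1 : ℍ → ℝ≥0∞) (g⁻¹ • z) = 2 := by
  filter_upwards [ae_smul_notMem_fd_diff_fdo] with z hz
  obtain ⟨g, hg⟩ := ModularGroup.exists_smul_mem_fd z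
  have hgo : g • z ∈ 𝒟ᵒ := by
    by_contra h
    exact hz g ⟨hg, h⟩
  have hindicator : ∀ h : SL(2, ℤ), fd.indicator (1 : ℍ → ℝ≥0∞) ((h * g)⁻¹⁻¹ • z) =
      if h ∈ ({1, -1} : Finset SL(2, ℤ)) then 1 else 0 := fun h ↦ by
    classical rw [inv_inv, mul_smul, indicator_apply, smul_mem_fd_iff_of_mem_fdo hgo]
    simp only [Finset.mem_insert, Finset.mem_singleton, Pi.one_apply]
  have hne : (1 : SL(2, ℤ)) ≠ -1 := by decide
  rw [← ((Equiv.mulRight g).trans (Equiv.inv SL(2, ℤ))).tsum_eq]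
  simp only [Equiv.trans_apply, Equiv.coe_mulRight, Equiv.inv_apply, hindicator]
  rw [tsum_eq_sum (s := {1, -1}) fun h hh ↦ if_neg hh, Finset.sum_congr rfl fun h hh ↦ if_pos hh,
    Finset.sum_const, Finset.card_pair hne]
  simp

theorem setIntegral_fd_tsum_smul {E : Type*} [NormedAddCommGroup E] [NormedSpace ℝ E]
    [CompleteSpace E] {φ : ℍ → E} (hφ : Integrable φ) :
    ∫ z in 𝒟, ∑' g : SL(2, ℤ), φ (g • z) = (2 : ℝ) • ∫ z, φ z := by
  simpa using setIntegral_tsum_smul measurableSet_fd ENNReal.ofNat_ne_top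
    ae_tsum_indicator_fd_smul hφ

end ModularGroupAction

section KernelDenom

/-- The weight `k` Bergman kernel of the upper half-plane, as a holomorphic function of `z`. Up to
a constant, it reproduces the values at `w` of holomorphic functions of weight `k`. -/
noncomputable def bergmanKernel (k : ℕ) (w z : ℍ) : ℂ :=
  (2 * Complex.I / ((z : ℂ) - conj (w : ℂ))) ^ k

/-- The form `(cz + d) (gz - conj w)` for `g = (a, b; c, d)`: the denominator of the Bergman kernel
translated by `g`, and the modulus of which measures the hyperbolic distance from `w` to `gz`. -/
noncomputable def kernelDenom (g : SL(2, ℤ)) (w z : ℂ) : ℂ :=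
  (g 0 0 : ℂ) * z + g 0 1 - conj w * ((g 1 0 : ℂ) * z + g 1 1)

theorem specialLinearGroup_det_entries (g : SL(2, ℤ)) :
    (g 0 0 * g 1 1 - g 0 1 * g 1 0 : ℝ) = 1 := by
  have h : g 0 0 * g 1 1 - g 0 1 * g 1 0 = 1 := by
    rw [← Matrix.det_fin_two, g.det_coe]
  exact_mod_cast h

theorem denom_specialLinearGroup (g : SL(2, ℤ)) (z : ℂ) :
    UpperHalfPlane.denom (g : GL (Fin 2) ℝ) z = (g 1 0 : ℂ) * z + g 1 1 := by
  simp [UpperHalfPlane.denom]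

theorem bergmanKernel_slash (k : ℕ) (w z : ℍ) (g : SL(2, ℤ)) :
    (bergmanKernel k w ∣[(k : ℤ)] g) z = (2 * Complex.I / kernelDenom g w z) ^ k := by
  have h0 := UpperHalfPlane.denom_ne_zero (g : GL (Fin 2) ℝ) z
  rw [denom_specialLinearGroup] at h0
  rw [ModularForm.SL_slash_apply, denom_specialLinearGroup, bergmanKernel, zpow_neg, zpow_natCast,
    ← inv_pow, ← mul_pow, UpperHalfPlane.coe_specialLinearGroup_apply, kernelDenom]
  simp only [algebraMap_int_eq, eq_intCast, Complex.ofReal_intCast]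
  rw [← div_eq_mul_inv, div_div, sub_mul, div_mul_cancel₀ _ h0]

theorem norm_kernelDenom_sq (g : SL(2, ℤ)) (w z : ℂ) :
    ‖kernelDenom g w z‖ ^ 2 =
      ((g 0 0 - g 1 0 * w.re) * z.re + (g 0 1 - g 1 1 * w.re)) ^ 2 + (w.im * g 1 0 * z.im) ^ 2 +
        ((g 0 0 - g 1 0 * w.re) * z.im) ^ 2 + (w.im * (g 1 0 * z.re + g 1 1)) ^ 2 +
        2 * (w.im * z.im) := by
  rw [← Complex.normSq_eq_norm_sq, Complex.normSq_apply]
  simp only [kernelDenom, Complex.sub_re, Complex.add_re, Complex.mul_re, Complex.intCast_re,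
    Complex.intCast_im, Complex.conj_re, Complex.add_im, Complex.mul_im, Complex.conj_im,
    Complex.sub_im]
  linear_combination (2 * w.im * z.im) * specialLinearGroup_det_entries g

theorem two_mul_im_mul_im_le_norm_kernelDenom_sq (g : SL(2, ℤ)) (w z : ℂ) :
    2 * (w.im * z.im) ≤ ‖kernelDenom g w z‖ ^ 2 := by
  rw [norm_kernelDenom_sq]
  exact le_add_of_nonneg_left (by positivity)

theorem kernelDenom_ne_zero (g : SL(2, ℤ)) {w z : ℂ} (hw : 0 < w.im) (hz : 0 < z.im) :
    kernelDenom g w z ≠ 0 := by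
  have h := two_mul_im_mul_im_le_norm_kernelDenom_sq g w z
  have hpos : 0 < 2 * (w.im * z.im) := by positivity
  exact norm_ne_zero_iff.mp (sq_pos_iff.mp (hpos.trans_le h))

theorem im_mul_norm_denom_le_norm_kernelDenom (g : SL(2, ℤ)) {w z : ℂ} (hw : 0 < w.im)
    (hz : 0 < z.im) : w.im * ‖(g 1 0 : ℂ) * z + g 1 1‖ ≤ ‖kernelDenom g w z‖ := by
  refine (sq_le_sq₀ (by positivity) (norm_nonneg _)).mp ?_
  rw [mul_pow, norm_kernelDenom_sq, ← Complex.normSq_eq_norm_sq, Complex.normSq_apply]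
  simp only [Complex.add_re, Complex.mul_re, Complex.intCast_re, Complex.intCast_im,
    Complex.add_im, Complex.mul_im]
  have := mul_pos hw hz
  nlinarith [sq_nonneg ((g 0 0 - g 1 0 * w.re) * z.re + (g 0 1 - g 1 1 * w.re)),
    sq_nonneg ((g 0 0 - g 1 0 * w.re) * z.im)]

theorem im_mul_norm_num_le_norm_kernelDenom (g : SL(2, ℤ)) {w z : ℂ} (hw : 0 < w.im)
    (hz : 0 < z.im) :
    w.im * ‖(g 0 0 : ℂ) * z + g 0 1‖ ≤ 2 * ‖w‖ * ‖kernelDenom g w z‖ := by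
  have htriangle : ‖(g 0 0 : ℂ) * z + g 0 1‖ ≤
      ‖kernelDenom g w z‖ + ‖w‖ * ‖(g 1 0 : ℂ) * z + g 1 1‖ := by
    rw [← Complex.norm_conj w, ← norm_mul]
    exact norm_le_norm_sub_add _ _
  have him : w.im ≤ ‖w‖ := (le_abs_self _).trans (Complex.abs_im_le_norm w)
  calc w.im * ‖(g 0 0 : ℂ) * z + g 0 1‖
      ≤ w.im * (‖kernelDenom g w z‖ + ‖w‖ * ‖(g 1 0 : ℂ) * z + g 1 1‖) := by gcongr
    _ = w.im * ‖kernelDenom g w z‖ + ‖w‖ * (w.im * ‖(g 1 0 : ℂ) * z + g 1 1‖) := by ring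
    _ ≤ ‖w‖ * ‖kernelDenom g w z‖ + ‖w‖ * ‖kernelDenom g w z‖ := by
      gcongr
      exact im_mul_norm_denom_le_norm_kernelDenom g hw hz
    _ = 2 * ‖w‖ * ‖kernelDenom g w z‖ := by ring

end KernelDenom

section Summability

/-- A summable weight on `SL(2, ℤ)`, decaying like the inverse sixth power of the matrix. It
dominates the translated Bergman kernels uniformly on vertical strips. -/
noncomputable def rowWeight (g : SL(2, ℤ)) : ℝ := (‖g 0‖ ^ 3)⁻¹ * (‖g 1‖ ^ 3)⁻¹

theorem rowWeight_nonneg (g : SL(2, ℤ)) : 0 ≤ rowWeight g := by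
  unfold rowWeight
  positivity

theorem summable_rowWeight : Summable rowWeight := by
  have h : Summable fun x : Fin 2 → ℤ ↦ (‖x‖ ^ 3)⁻¹ :=
    (EisensteinSeries.summable_one_div_norm_rpow (k := 3) (by norm_num)).congr fun x ↦ by
      rw [Real.rpow_neg (norm_nonneg x)]
      norm_cast
  have hnonneg : 0 ≤ fun x : Fin 2 → ℤ ↦ (‖x‖ ^ 3)⁻¹ := fun x ↦ by
    simp only [Pi.zero_apply]
    positivity
  refine (h.mul_of_nonneg h hnonneg hnonneg).comp_injective
    (i := fun g : SL(2, ℤ) ↦ (g 0, g 1)) fun g g' hg ↦ ?_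
  rw [Prod.mk.injEq] at hg
  exact Subtype.ext (funext (Fin.forall_fin_two.mpr hg))

theorem specialLinearGroup_row_ne_zero (g : SL(2, ℤ)) (i : Fin 2) : g i ≠ 0 := by
  intro h
  have hdet := g.det_coe
  rw [Matrix.det_eq_zero_of_row_eq_zero i (congrFun h)] at hdet
  exact zero_ne_one hdet

theorem exists_norm_kernelDenom_pow_inv_le {A B : ℝ} (hB : 0 < B) (w : ℍ) :
    ∃ C : ℝ, 0 < C ∧ ∀ g : SL(2, ℤ), ∀ z ∈ verticalStrip A B,
      (‖kernelDenom g w z‖ ^ 6)⁻¹ ≤ C * rowWeight g := by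
  have hw := w.im_pos
  have hr : 0 < r ⟨⟨A, B⟩, hB⟩ := EisensteinSeries.r_pos _
  set ρ := r ⟨⟨A, B⟩, hB⟩
  have hw0 : 0 < ‖(w : ℂ)‖ := norm_pos_iff.mpr w.ne_zero
  have hrow : ∀ g : SL(2, ℤ), ∀ i, 0 < ‖g i‖ := fun g i ↦
    norm_pos_iff.mpr (specialLinearGroup_row_ne_zero g i)
  refine ⟨((w.im * ρ) ^ 3 * (w.im * ρ / (2 * ‖(w : ℂ)‖)) ^ 3)⁻¹, by positivity, fun g z hz ↦ ?_⟩
  have hlinear : ∀ i, ρ * ‖g i‖ ≤ ‖(g i 0 : ℂ) * z + g i 1‖ := fun i ↦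
    (mul_le_mul_of_nonneg_right (EisensteinSeries.r_lower_bound_on_verticalStrip z hB hz)
      (norm_nonneg _)).trans
      (EisensteinSeries.r_mul_max_le z (specialLinearGroup_row_ne_zero g i))
  have hbottom : w.im * ρ * ‖g 1‖ ≤ ‖kernelDenom g w z‖ := by
    rw [mul_assoc]
    exact (mul_le_mul_of_nonneg_left (hlinear 1) hw.le).trans
      (im_mul_norm_denom_le_norm_kernelDenom g hw z.im_pos)
  have htop : w.im * ρ / (2 * ‖(w : ℂ)‖) * ‖g 0‖ ≤ ‖kernelDenom g w z‖ := by
    rw [div_mul_eq_mul_div, div_le_iff₀ (by positivity), mul_assoc, mul_comm ‖kernelDenom g w z‖]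
    exact (mul_le_mul_of_nonneg_left (hlinear 0) hw.le).trans
      (im_mul_norm_num_le_norm_kernelDenom g hw z.im_pos)
  have := hrow g 0
  have := hrow g 1
  calc (‖kernelDenom g w z‖ ^ 6)⁻¹ = (‖kernelDenom g w z‖ ^ 3 * ‖kernelDenom g w z‖ ^ 3)⁻¹ := by
        ring
    _ ≤ ((w.im * ρ * ‖g 1‖) ^ 3 * (w.im * ρ / (2 * ‖(w : ℂ)‖) * ‖g 0‖) ^ 3)⁻¹ := by gcongr
    _ = ((w.im * ρ) ^ 3 * (w.im * ρ / (2 * ‖(w : ℂ)‖)) ^ 3)⁻¹ * rowWeight g := by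
        rw [rowWeight, mul_pow, mul_pow _ ‖g 0‖, mul_mul_mul_comm, mul_inv, mul_inv (‖g 1‖ ^ 3),
          mul_comm (‖g 1‖ ^ 3)⁻¹]

theorem exists_norm_kernel_term_le {A B : ℝ} (hB : 0 < B) (w : ℍ) (m : ℕ) :
    ∃ C : ℝ, 0 < C ∧ ∀ g : SL(2, ℤ), ∀ z ∈ verticalStrip A B,
      ‖(2 * Complex.I / kernelDenom g w z) ^ (m + 6)‖ ≤ C * (√z.im)⁻¹ ^ m * rowWeight g := by
  have := w.im_pos
  obtain ⟨C, hC, hCbound⟩ := exists_norm_kernelDenom_pow_inv_le (A := A) hB w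
  refine ⟨2 ^ (m + 6) * (√(2 * w.im))⁻¹ ^ m * C, by positivity, fun g z hz ↦ ?_⟩
  have := z.im_pos
  have hsqrt : √(2 * w.im) * √z.im ≤ ‖kernelDenom g w z‖ := by
    rw [← Real.sqrt_mul (by positivity), mul_assoc]
    exact Real.sqrt_le_iff.mpr ⟨norm_nonneg _, two_mul_im_mul_im_le_norm_kernelDenom_sq g w z⟩
  calc ‖(2 * Complex.I / kernelDenom g w z) ^ (m + 6)‖
      = 2 ^ (m + 6) * (‖kernelDenom g w z‖⁻¹ ^ m * (‖kernelDenom g w z‖ ^ 6)⁻¹) := by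
        rw [norm_pow, norm_div, norm_mul, Complex.norm_I, Complex.norm_ofNat, mul_one, div_pow,
          ← inv_pow, ← pow_add, inv_pow, div_eq_mul_inv]
    _ ≤ 2 ^ (m + 6) * ((√(2 * w.im) * √z.im)⁻¹ ^ m * (C * rowWeight g)) := by
        gcongr
        exact hCbound g z hz
    _ = 2 ^ (m + 6) * (√(2 * w.im))⁻¹ ^ m * C * (√z.im)⁻¹ ^ m * rowWeight g := by
        rw [mul_inv, mul_pow]
        ring

theorem exists_summable_norm_kernel_term_le (A : ℝ) {B : ℝ} (hB : 0 < B) (w : ℍ) {k : ℕ}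
    (hk : 6 ≤ k) :
    ∃ u : SL(2, ℤ) → ℝ, Summable u ∧ ∀ g, ∀ z ∈ verticalStrip A B,
      ‖(2 * Complex.I / kernelDenom g w z) ^ k‖ ≤ u g := by
  obtain ⟨m, rfl⟩ := Nat.exists_eq_add_of_le' hk
  obtain ⟨C, hC, hCbound⟩ := exists_norm_kernel_term_le (A := A) hB w m
  refine ⟨fun g ↦ C * (√B)⁻¹ ^ m * rowWeight g, summable_rowWeight.mul_left _,
    fun g z hz ↦ (hCbound g z hz).trans ?_⟩
  have := rowWeight_nonneg g
  have hBz : B ≤ z.im := hz.2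
  change C * (√z.im)⁻¹ ^ m * rowWeight g ≤ C * (√B)⁻¹ ^ m * rowWeight g
  gcongr

theorem summable_norm_kernel_term (w z : ℍ) {k : ℕ} (hk : 6 ≤ k) :
    Summable fun g : SL(2, ℤ) ↦ ‖(2 * Complex.I / kernelDenom g w z) ^ k‖ := by
  obtain ⟨u, hu, hbound⟩ := exists_summable_norm_kernel_term_le |z.re| z.im_pos w hk
  exact hu.of_nonneg_of_le (fun g ↦ norm_nonneg _) fun g ↦ hbound g z ⟨le_rfl, le_rfl⟩

end Summability

section KernelSeries

/-- The Poincaré series of the Bergman kernel: the sum of its translates over `SL(2, ℤ)`. -/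
noncomputable def kernelSeries (k : ℕ) (w z : ℍ) : ℂ :=
  ∑' g : SL(2, ℤ), (2 * Complex.I / kernelDenom g w z) ^ k

theorem kernelSeries_eq_tsum_slash (k : ℕ) (w z : ℍ) :
    kernelSeries k w z = ∑' g : SL(2, ℤ), (bergmanKernel k w ∣[(k : ℤ)] g) z := by
  simp only [kernelSeries, bergmanKernel_slash]

theorem kernelSeries_slash (k : ℕ) (w : ℍ) (h : SL(2, ℤ)) :
    kernelSeries k w ∣[(k : ℤ)] h = kernelSeries k w := by
  ext z
  rw [ModularForm.SL_slash_apply, kernelSeries_eq_tsum_slash, kernelSeries_eq_tsum_slash,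
    ← tsum_mul_right, ← (Equiv.mulRight h).tsum_eq fun g ↦ (bergmanKernel k w ∣[(k : ℤ)] g) z]
  refine tsum_congr fun g ↦ ?_
  rw [Equiv.coe_mulRight, SlashAction.slash_mul, ModularForm.SL_slash_apply (γ := h)]

theorem mdifferentiable_kernelSeries {k : ℕ} (hk : 6 ≤ k) (w : ℍ) : MDiff (kernelSeries k w) := by
  rw [UpperHalfPlane.mdifferentiable_iff]
  intro z (hz : 0 < z.im)
  obtain ⟨u, hu, hbound⟩ := exists_summable_norm_kernel_term_le (|z.re| + 1) (half_pos hz) w hk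
  set U : Set ℂ := {z' : ℂ | |z'.re| < |z.re| + 1} ∩ {z' : ℂ | z.im / 2 < z'.im}
  have hU : IsOpen U := (isOpen_lt (by fun_prop) (by fun_prop)).inter
    (isOpen_lt (by fun_prop) (by fun_prop))
  have hzU : z ∈ U := ⟨lt_add_one |z.re|, half_lt_self hz⟩
  have hpos : ∀ z' ∈ U, 0 < z'.im := fun z' hz' ↦ (half_pos hz).trans hz'.2
  have hseries : DifferentiableOn ℂ (fun z' ↦ ∑' g : SL(2, ℤ),
      (2 * Complex.I / kernelDenom g w z') ^ k) U := by
    refine Complex.differentiableOn_tsum_of_summable_norm hu (fun g ↦ ?_) hU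
      fun g z' hz' ↦ hbound g ⟨z', hpos z' hz'⟩ ⟨hz'.1.le, hz'.2.le⟩
    exact .pow (.div (by fun_prop) (by unfold kernelDenom; fun_prop)
      fun z' hz' ↦ kernelDenom_ne_zero g w.im_pos (hpos z' hz')) _
  have hcomp : DifferentiableOn ℂ (kernelSeries k w ∘ UpperHalfPlane.ofComplex) U :=
    hseries.congr fun z' hz' ↦ by
      simp only [Function.comp_apply, kernelSeries,
        UpperHalfPlane.ofComplex_apply_of_im_pos (hpos z' hz')]
  exact (hcomp.differentiableAt (hU.mem_nhds hzU)).differentiableWithinAt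

theorem kernelSeries_T_zpow_smul (k : ℕ) (w z : ℍ) (n : ℤ) :
    kernelSeries k w (ModularGroup.T ^ n • z) = kernelSeries k w z := by
  have h0 : (ModularGroup.T ^ n) 1 0 = 0 := by simp [ModularGroup.coe_T_zpow]
  have h1 : (ModularGroup.T ^ n) 1 1 = 1 := by simp [ModularGroup.coe_T_zpow]
  conv_rhs => rw [← kernelSeries_slash k w (ModularGroup.T ^ n)]
  rw [ModularForm.SL_slash_apply, denom_specialLinearGroup, h0, h1]
  simp only [Int.cast_zero, zero_mul, Int.cast_one, zero_add, one_zpow, mul_one]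

theorem isZeroAtImInfty_kernelSeries {k : ℕ} (hk : 7 ≤ k) (w : ℍ) :
    UpperHalfPlane.IsZeroAtImInfty (kernelSeries k w) := by
  obtain ⟨m, rfl⟩ := Nat.exists_eq_add_of_le' (show 6 ≤ k by omega)
  obtain ⟨C, -, hC⟩ := exists_norm_kernel_term_le (A := 1) one_pos w m
  have hbound : ∀ z : ℍ, 1 ≤ z.im →
      ‖kernelSeries (m + 6) w z‖ ≤ C * (√z.im)⁻¹ ^ m * ∑' g, rowWeight g := by
    intro z hz
    obtain ⟨n, hn⟩ := UpperHalfPlane.ModularGroup_T_zpow_mem_verticalStrip z one_pos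
    rw [← kernelSeries_T_zpow_smul _ w z ((1 : ℕ) * n), ← tsum_mul_left]
    rw [Nat.cast_one] at hn
    refine tsum_of_norm_bounded (summable_rowWeight.mul_left _).hasSum fun g ↦ ?_
    simpa only [ModularGroup.im_T_zpow_smul] using
      hC g _ (UpperHalfPlane.verticalStrip_anti_right 1 hz hn)
  have hlim : Filter.Tendsto (fun z : ℍ ↦ C * (√z.im)⁻¹ ^ m * ∑' g, rowWeight g)
      UpperHalfPlane.atImInfty (nhds 0) := by
    have hm : m ≠ 0 := by omega
    have h := ((tendsto_inv_atTop_zero.comp Real.tendsto_sqrt_atTop).pow m).const_mul C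
      |>.mul_const (∑' g, rowWeight g)
    rw [zero_pow hm, mul_zero, zero_mul] at h
    exact h.comp Filter.tendsto_comap
  refine squeeze_zero_norm' ?_ hlim
  exact (Filter.tendsto_comap.eventually (Filter.eventually_ge_atTop 1)).mono hbound

/-- The Poincaré series of the Bergman kernel as a cusp form, for the weights `k` in which the
majorant used here converges and decays at the cusp. -/
noncomputable def kernelCuspForm {k : ℕ} (hk : 7 ≤ k) (w : ℍ) : CuspForm 𝒮ℒ (k : ℤ) where
  toFun := kernelSeries k w
  slash_action_eq' := fun _ ⟨γ, hγ⟩ ↦ hγ ▸ kernelSeries_slash k w γ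
  holo' := mdifferentiable_kernelSeries (by omega) w
  zero_at_cusps' hc := by
    rw [Subgroup.IsArithmetic.isCusp_iff_isCusp_SL2Z] at hc
    rw [OnePoint.isZeroAt_iff_forall_SL2Z hc]
    intro γ _
    rw [kernelSeries_slash]
    exact isZeroAtImInfty_kernelSeries hk w

theorem kernelCuspForm_apply {k : ℕ} (hk : 7 ≤ k) (w z : ℍ) :
    kernelCuspForm hk w z = kernelSeries k w z := rfl

end KernelSeries

section Pretrace

variable {k : ℕ}

theorem inv_im_sq_smul_petersson_bergmanKernel (hk : 2 ≤ k) (f : ℍ → ℂ) (w : ℍ) {z : ℂ}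
    (hz : z ∈ upperHalfPlaneSet) :
    ((1 / z.im) ^ 2 : ℝ) • petersson k (bergmanKernel k w) f (ofComplex z) =
      bergmanIntegrand (k - 2) (f ∘ ofComplex) w z := by
  have h0 : (z.im : ℂ) ≠ 0 := Complex.ofReal_ne_zero.mpr (ne_of_gt hz)
  obtain ⟨n, rfl⟩ := Nat.exists_eq_add_of_le' hk
  simp only [petersson, bergmanKernel, bergmanIntegrand, Nat.add_sub_cancel, Complex.real_smul,
    Function.comp_apply, UpperHalfPlane.ofComplex_apply_of_im_pos hz, UpperHalfPlane.mk_im,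
    zpow_natCast]
  push_cast
  rw [pow_add (z.im : ℂ)]
  field_simp

theorem exists_norm_sq_mul_im_pow_le (f : CuspForm 𝒮ℒ (k : ℤ)) :
    ∃ M : ℝ, ∀ z ∈ upperHalfPlaneSet, ‖(f ∘ ofComplex) z‖ ^ 2 * z.im ^ k ≤ M := by
  obtain ⟨M, hM⟩ := CuspFormClass.petersson_bounded_left (k : ℤ) 𝒮ℒ f f
  refine ⟨M, fun z hz ↦ le_of_eq_of_le ?_ (hM (ofComplex z))⟩
  rw [UpperHalfPlane.ofComplex_apply_of_im_pos hz]
  simp [petersson, UpperHalfPlane.ofComplex_apply_of_im_pos hz,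
    abs_of_pos (show 0 < z.im from hz), sq]

theorem integrable_petersson_bergmanKernel (hk : 4 ≤ k) (f : CuspForm 𝒮ℒ (k : ℤ)) (w : ℍ) :
    Integrable (petersson k (bergmanKernel k w) f) := by
  obtain ⟨M, hM⟩ := exists_norm_sq_mul_im_pow_le f
  have hinteg := integrableOn_bergmanIntegrand w.im_pos (n := k - 2) (by omega)
    (UpperHalfPlane.mdifferentiable_iff.mp f.holo') (M := M)
    (by rwa [Nat.sub_add_cancel (by omega)])
  have hcomp := (integrable_upperHalfPlane_iff_integrableOn fun z : ℂ ↦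
    petersson k (bergmanKernel k w) f (ofComplex z)).mpr <|
      hinteg.congr_fun (fun z hz ↦
        (inv_im_sq_smul_petersson_bergmanKernel (by omega) f w hz).symm)
        UpperHalfPlane.isOpen_upperHalfPlaneSet.measurableSet
  simpa only [UpperHalfPlane.ofComplex_apply] using hcomp

theorem integral_petersson_bergmanKernel (hk : 4 ≤ k) (f : CuspForm 𝒮ℒ (k : ℤ)) (w : ℍ) :
    ∫ τ, petersson k (bergmanKernel k w) f τ = 4 * Real.pi / (k - 1) * f w := by
  obtain ⟨M, hM⟩ := exists_norm_sq_mul_im_pow_le f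
  have hk2 : ((k - 2 : ℕ) : ℂ) + 1 = k - 1 := by
    rw [Nat.cast_sub (by omega)]
    ring
  calc ∫ τ, petersson k (bergmanKernel k w) f τ
      = ∫ τ : ℍ, petersson k (bergmanKernel k w) f (ofComplex τ) := by
        simp only [UpperHalfPlane.ofComplex_apply]
    _ = ∫ z in upperHalfPlaneSet, bergmanIntegrand (k - 2) (f ∘ ofComplex) w z := by
        rw [integral_upperHalfPlane_eq_setIntegral fun z : ℂ ↦
          petersson k (bergmanKernel k w) f (ofComplex z)]
        exact setIntegral_congr_fun UpperHalfPlane.isOpen_upperHalfPlaneSet.measurableSet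
          fun z hz ↦ inv_im_sq_smul_petersson_bergmanKernel (by omega) f w hz
    _ = 4 * Real.pi / (k - 1) * f w := by
        refine (setIntegral_bergmanIntegrand w.im_pos (by omega)
          (UpperHalfPlane.mdifferentiable_iff.mp f.holo') (M := M)
          (by rwa [Nat.sub_add_cancel (by omega)])).trans ?_
        rw [hk2, Function.comp_apply, UpperHalfPlane.ofComplex_apply]
        rfl

theorem petersson_kernelSeries_eq_tsum (f : CuspForm 𝒮ℒ (k : ℤ)) (w z : ℍ) :
    petersson k (kernelSeries k w) f z =
      ∑' g : SL(2, ℤ), petersson k (bergmanKernel k w) f (g • z) := by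
  have hterm : ∀ g : SL(2, ℤ), petersson k (bergmanKernel k w) f (g • z) =
      conj ((2 * Complex.I / kernelDenom g w z) ^ k) * (f z * (z.im : ℂ) ^ (k : ℤ)) := fun g ↦ by
    have hf : (f : ℍ → ℂ) ∣[(k : ℤ)] g = f := f.slash_action_eq' _ ⟨g, rfl⟩
    rw [← UpperHalfPlane.petersson_slash_SL, hf, petersson, bergmanKernel_slash, mul_assoc]
  simp only [hterm]
  rw [tsum_mul_right, ← Complex.conj_tsum, petersson, kernelSeries, mul_assoc]

theorem peterssonInner_kernelCuspForm (hk : 7 ≤ k) (f : CuspForm 𝒮ℒ (k : ℤ)) (w : ℍ) :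
    peterssonInner k (kernelCuspForm hk w) f = 8 * Real.pi / (k - 1) * f w := by
  calc peterssonInner k (kernelCuspForm hk w) f
      = ∫ z in 𝒟, ∑' g : SL(2, ℤ), petersson k (bergmanKernel k w) f (g • z) := by
        simp only [← petersson_kernelSeries_eq_tsum]
        rfl
    _ = (2 : ℝ) • (4 * Real.pi / (k - 1) * f w) := by
        rw [setIntegral_fd_tsum_smul (integrable_petersson_bergmanKernel (by omega) f w),
          integral_petersson_bergmanKernel (by omega)]
    _ = 8 * Real.pi / (k - 1) * f w := by
        rw [Complex.real_smul]
        push_cast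
        ring

theorem norm_petersson_le_add (f g : ℍ → ℂ) (z : ℍ) :
    ‖petersson k f g z‖ ≤ ‖petersson k f f z‖ + ‖petersson k g g z‖ := by
  have h := two_mul_le_add_sq ‖f z‖ ‖g z‖
  simp only [petersson, norm_mul, RCLike.norm_conj, ← sq, ← add_mul]
  gcongr
  nlinarith [mul_nonneg (norm_nonneg (f z)) (norm_nonneg (g z))]

variable {ι : Type*} {B : Module.Basis ι ℂ (CuspForm 𝒮ℒ (k : ℤ))}

theorem IsPeterssonOrthonormal.integrableOn (hB : IsPeterssonOrthonormal B) (i j : ι) :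
    IntegrableOn (petersson k (B i) (B j)) 𝒟 := by
  have hdiag : ∀ i, IntegrableOn (petersson k (B i) (B i)) 𝒟 := fun i ↦ by
    by_contra h
    have hone := hB.1 i
    rw [peterssonInner, integral_undef h] at hone
    exact zero_ne_one hone
  refine Integrable.mono' ((hdiag i).norm.add (hdiag j).norm) ?_
    (.of_forall fun z ↦ norm_petersson_le_add _ _ z)
  exact (UpperHalfPlane.petersson_continuous _ (B i).holo'.continuous
    (B j).holo'.continuous).aestronglyMeasurable

theorem cuspForm_sum_smul_apply [Fintype ι] (c : ι → ℂ) (z : ℍ) :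
    (∑ i, c i • B i : CuspForm 𝒮ℒ (k : ℤ)) z = ∑ i, c i * B i z := by
  simp

theorem petersson_sum_smul [Fintype ι] (c : ι → ℂ) (f : ℍ → ℂ) (z : ℍ) :
    petersson k (∑ i, c i • B i : CuspForm 𝒮ℒ (k : ℤ)) f z =
      ∑ i, conj (c i) * petersson k (B i) f z := by
  simp only [petersson, cuspForm_sum_smul_apply, map_sum, map_mul, Finset.sum_mul, mul_assoc]

theorem peterssonInner_sum_smul [Fintype ι] (hB : IsPeterssonOrthonormal B) (c : ι → ℂ)
    (j : ι) :
    peterssonInner k (∑ i, c i • B i) (B j) = conj (c j) := by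
  calc peterssonInner k (∑ i, c i • B i) (B j)
      = ∑ i, conj (c i) * peterssonInner k (B i) (B j) := by
        simp only [peterssonInner, petersson_sum_smul]
        rw [integral_finsetSum _ fun i _ ↦ (hB.integrableOn i j).const_mul _]
        simp only [integral_const_mul]
    _ = conj (c j) * peterssonInner k (B j) (B j) :=
        Finset.sum_eq_single j (fun i _ hij ↦ by rw [hB.2 i j hij, mul_zero]) (by simp)
    _ = conj (c j) := by rw [hB.1 j, mul_one]

theorem repr_kernelCuspForm [Finite ι] (hk : 7 ≤ k) (hB : IsPeterssonOrthonormal B) (w : ℍ)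
    (j : ι) :
    B.repr (kernelCuspForm hk w) j = 8 * Real.pi / (k - 1) * conj (B j w) := by
  cases nonempty_fintype ι
  have h := peterssonInner_sum_smul hB (B.repr (kernelCuspForm hk w)) j
  rw [B.sum_repr, peterssonInner_kernelCuspForm] at h
  rw [← Complex.conj_conj (B.repr _ j), ← h]
  simp [map_ofNat (starRingEnd ℂ) 8]

theorem kernelSeries_eq_sum [Fintype ι] (hk : 7 ≤ k) (hB : IsPeterssonOrthonormal B)
    (w z : ℍ) :
    kernelSeries k w z = 8 * Real.pi / (k - 1) * ∑ i, conj (B i w) * B i z := by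
  rw [← kernelCuspForm_apply hk, ← B.sum_repr (kernelCuspForm hk w), cuspForm_sum_smul_apply,
    Finset.mul_sum]
  simp only [repr_kernelCuspForm hk hB, mul_assoc]

end Pretrace

section LorentzianIntegral

theorem lintegral_inv_one_add_sq :
    ∫⁻ t : ℝ, ENNReal.ofReal (1 + t ^ 2)⁻¹ = ENNReal.ofReal Real.pi := by
  rw [← ofReal_integral_eq_lintegral_ofReal integrable_inv_one_add_sq
    (.of_forall fun t ↦ by positivity), integral_univ_inv_one_add_sq]

theorem mul_setLIntegral_inv_one_add_sq_le {u u' : ℝ → ℝ} {s : Set ℝ} {p : ℝ}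
    (hs : MeasurableSet s) (hu : ∀ y ∈ s, HasDerivWithinAt u (u' y) s y) (hinj : InjOn u s)
    (hp : ∀ y ∈ s, p ≤ |u' y|) :
    ENNReal.ofReal p * ∫⁻ y in s, ENNReal.ofReal (1 + u y ^ 2)⁻¹ ≤ ENNReal.ofReal Real.pi := by
  calc ENNReal.ofReal p * ∫⁻ y in s, ENNReal.ofReal (1 + u y ^ 2)⁻¹
      = ∫⁻ y in s, ENNReal.ofReal p * ENNReal.ofReal (1 + u y ^ 2)⁻¹ :=
        (lintegral_const_mul' _ _ ENNReal.ofReal_ne_top).symm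
    _ ≤ ∫⁻ y in s, ENNReal.ofReal |u' y| * ENNReal.ofReal (1 + u y ^ 2)⁻¹ := by
        refine setLIntegral_mono' hs fun y hy ↦ ?_
        gcongr
        exact hp y hy
    _ = ∫⁻ t in u '' s, ENNReal.ofReal (1 + t ^ 2)⁻¹ :=
        (lintegral_image_eq_lintegral_abs_deriv_mul hs hu hinj
          fun t ↦ ENNReal.ofReal (1 + t ^ 2)⁻¹).symm
    _ ≤ ∫⁻ t, ENNReal.ofReal (1 + t ^ 2)⁻¹ := setLIntegral_le_lintegral _ _
    _ = ENNReal.ofReal Real.pi := lintegral_inv_one_add_sq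

theorem setLIntegral_Ioi_inv_one_add_mul_sub_div_sq_le {p q : ℝ} (hp : 0 < p) (hq : 0 ≤ q) :
    ∫⁻ y in Ioi (0 : ℝ), ENNReal.ofReal (1 + (p * y - q / y) ^ 2)⁻¹ ≤
      ENNReal.ofReal (Real.pi / p) := by
  have hderiv : ∀ y ∈ Ioi (0 : ℝ),
      HasDerivWithinAt (fun y ↦ p * y - q / y) (p + q / y ^ 2) (Ioi 0) y := fun y hy ↦ by
    have h := ((hasDerivAt_id' y).const_mul p).sub ((hasDerivAt_inv hy.ne').const_mul q)
    exact (h.congr_deriv (by ring)).hasDerivWithinAt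
  have hmono : StrictMonoOn (fun y ↦ p * y - q / y) (Ioi 0) := fun y hy z _ hyz ↦ by
    have hy0 : 0 < y := hy
    have hlin : p * y < p * z := by gcongr
    have hinv : q / z ≤ q / y := by gcongr
    linarith
  have hlower : ∀ y ∈ Ioi (0 : ℝ), p ≤ |p + q / y ^ 2| := fun y _ ↦
    (le_add_of_nonneg_right (by positivity)).trans (le_abs_self _)
  rw [ENNReal.ofReal_div_of_pos hp,
    ENNReal.le_div_iff_mul_le (.inl (ENNReal.ofReal_pos.mpr hp).ne') (.inl ENNReal.ofReal_ne_top),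
    mul_comm]
  exact mul_setLIntegral_inv_one_add_sq_le measurableSet_Ioi hderiv hmono.injOn hlower

end LorentzianIntegral

section CoshSq

/-- The value of `cosh²` at half the hyperbolic distance from `iy` to its image under the real
matrix `(α, s; c, δ)` of determinant one. -/
noncomputable def coshSq (α s c δ y : ℝ) : ℝ :=
  (s ^ 2 / y ^ 2 + c ^ 2 * y ^ 2 + α ^ 2 + δ ^ 2 + 2) / 4

variable {α s c δ y : ℝ}

theorem one_add_sq_le_coshSq (h : α * δ - s * c = 1) (hy : 0 < y) :
    1 + ((|c| * y - |s| / y) / 2) ^ 2 ≤ coshSq α s c δ y := by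
  have hexpand : 4 * coshSq α s c δ y =
      (|c| * y - |s| / y) ^ 2 + 2 * |s * c| + (α ^ 2 + δ ^ 2) + 2 := by
    rw [coshSq, ← sq_abs c, ← sq_abs s, abs_mul]
    field_simp
    ring
  have hdiag : 2 * |α * δ| ≤ α ^ 2 + δ ^ 2 := by
    rw [← sq_abs α, ← sq_abs δ, abs_mul, ← mul_assoc]
    exact two_mul_le_add_sq _ _
  have hdet : 1 ≤ |α * δ| + |s * c| := by
    rw [← abs_one, ← h]
    exact abs_sub _ _
  linarith

theorem one_le_coshSq (h : α * δ - s * c = 1) (hy : 0 < y) : 1 ≤ coshSq α s c δ y :=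
  (le_add_of_nonneg_right (sq_nonneg _)).trans (one_add_sq_le_coshSq h hy)

theorem prod_one_add_sq_le_coshSq_cube (α s c δ y : ℝ) :
    (1 + α ^ 2) * (1 + δ ^ 2) * (1 + (c * y) ^ 2) ≤ (4 * coshSq α s c δ y) ^ 3 := by
  have hsum : 1 + (α ^ 2 + δ ^ 2 + (c * y) ^ 2) ≤ 4 * coshSq α s c δ y := by
    have hs : 0 ≤ s ^ 2 / y ^ 2 := by positivity
    rw [coshSq]
    linarith
  have hα := sq_nonneg α
  have hδ := sq_nonneg δ
  have hcy := sq_nonneg (c * y)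
  have hP : 0 ≤ 4 * coshSq α s c δ y := by linarith
  rw [pow_three']
  gcongr <;> linarith

theorem mul_mul_le_coshSq_pow (h : α * δ - s * c = 1) (hy : 0 < y) (n : ℕ) :
    (1 + α ^ 2) * (1 + δ ^ 2) * (|c| * y / 32) *
      (1 + (√n / 2 * |c| * y - √n / 2 * |s| / y) ^ 2) ≤ coshSq α s c δ y ^ (n + 3) := by
  set P := coshSq α s c δ y
  have hP : 1 ≤ P := one_le_coshSq h hy
  have hcube : (1 + α ^ 2) * (1 + δ ^ 2) * (|c| * y / 32) ≤ P ^ 3 := by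
    have hcy : 2 * (|c| * y) ≤ 1 + (c * y) ^ 2 := by
      have habs : |c| * y = |c * y| := by rw [abs_mul, abs_of_pos hy]
      rw [habs, ← sq_abs (c * y)]
      linarith [two_mul_le_add_sq 1 |c * y|]
    have hprod : (1 + α ^ 2) * (1 + δ ^ 2) * (2 * (|c| * y)) ≤
        (1 + α ^ 2) * (1 + δ ^ 2) * (1 + (c * y) ^ 2) := by gcongr
    linarith [prod_one_add_sq_le_coshSq_cube α s c δ y]
  have hbernoulli : 1 + (√n / 2 * |c| * y - √n / 2 * |s| / y) ^ 2 ≤ P ^ n := by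
    calc 1 + (√n / 2 * |c| * y - √n / 2 * |s| / y) ^ 2
        = 1 + √n ^ 2 * ((|c| * y - |s| / y) / 2) ^ 2 := by ring
      _ = 1 + n * ((|c| * y - |s| / y) / 2) ^ 2 := by rw [Real.sq_sqrt n.cast_nonneg]
      _ ≤ 1 + n * (P - 1) := by
        gcongr
        linarith [one_add_sq_le_coshSq h hy]
      _ ≤ P ^ n := by
        simpa only [add_sub_cancel] using
          one_add_mul_le_pow (show -2 ≤ P - 1 by linarith) n
  rw [add_comm n, pow_add]
  gcongr

theorem inv_coshSq_pow_mul_le (h : α * δ - s * c = 1) (hc : c ≠ 0) (hy : 0 < y) (n : ℕ) :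
    (coshSq α s c δ y ^ (n + 3) * y)⁻¹ ≤ 32 * y⁻¹ ^ 2 * ((1 + α ^ 2) * (1 + δ ^ 2) * |c|)⁻¹ *
      (1 + (√n / 2 * |c| * y - √n / 2 * |s| / y) ^ 2)⁻¹ := by
  have : 0 < |c| := abs_pos.mpr hc
  set L := 1 + (√n / 2 * |c| * y - √n / 2 * |s| / y) ^ 2
  have hL0 : 0 < L := by positivity
  calc (coshSq α s c δ y ^ (n + 3) * y)⁻¹
      ≤ ((1 + α ^ 2) * (1 + δ ^ 2) * (|c| * y / 32) * L * y)⁻¹ := by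
        gcongr
        exact mul_mul_le_coshSq_pow h hy n
    _ = 32 * y⁻¹ ^ 2 * ((1 + α ^ 2) * (1 + δ ^ 2) * |c|)⁻¹ * L⁻¹ := by
        field_simp

theorem setLIntegral_inv_coshSq_pow_mul_le (h : α * δ - s * c = 1) (hc : c ≠ 0) {n : ℕ}
    (hn : 0 < n) {Y : ℝ} (hY : 0 < Y) (T : ℝ) :
    ∫⁻ y in Ioo Y⁻¹ T, ENNReal.ofReal (coshSq α s c δ y ^ (n + 3) * y)⁻¹ ≤
      ENNReal.ofReal (64 * Real.pi * Y ^ 2 / √n * ((1 + α ^ 2) * (1 + δ ^ 2) * c ^ 2)⁻¹) := by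
  have : 0 < |c| := abs_pos.mpr hc
  have : 0 < √(n : ℝ) := Real.sqrt_pos.mpr (Nat.cast_pos.mpr hn)
  set M := 32 * Y ^ 2 * ((1 + α ^ 2) * (1 + δ ^ 2) * |c|)⁻¹ with hM
  have hM0 : 0 ≤ M := by positivity
  have hsub : Ioo Y⁻¹ T ⊆ Ioi 0 := fun y hy ↦ (inv_pos.mpr hY).trans hy.1
  have hpointwise : ∀ y ∈ Ioo Y⁻¹ T, (coshSq α s c δ y ^ (n + 3) * y)⁻¹ ≤
      M * (1 + (√n / 2 * |c| * y - √n / 2 * |s| / y) ^ 2)⁻¹ := fun y hy ↦ by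
    have hy0 : 0 < y := hsub hy
    refine (inv_coshSq_pow_mul_le h hc hy0 n).trans ?_
    rw [hM]
    gcongr
    exact inv_le_of_inv_le₀ hY hy.1.le
  calc ∫⁻ y in Ioo Y⁻¹ T, ENNReal.ofReal (coshSq α s c δ y ^ (n + 3) * y)⁻¹
      ≤ ∫⁻ y in Ioo Y⁻¹ T, ENNReal.ofReal M *
          ENNReal.ofReal (1 + (√n / 2 * |c| * y - √n / 2 * |s| / y) ^ 2)⁻¹ := by
        refine setLIntegral_mono' measurableSet_Ioo fun y hy ↦ ?_
        rw [← ENNReal.ofReal_mul hM0]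
        exact ENNReal.ofReal_le_ofReal (hpointwise y hy)
    _ = ENNReal.ofReal M * ∫⁻ y in Ioo Y⁻¹ T,
          ENNReal.ofReal (1 + (√n / 2 * |c| * y - √n / 2 * |s| / y) ^ 2)⁻¹ :=
        lintegral_const_mul' _ _ ENNReal.ofReal_ne_top
    _ ≤ ENNReal.ofReal M * ENNReal.ofReal (Real.pi / (√n / 2 * |c|)) := by
        gcongr
        exact (lintegral_mono_set hsub).trans
          (setLIntegral_Ioi_inv_one_add_mul_sub_div_sq_le (by positivity) (by positivity))
    _ = ENNReal.ofReal
          (64 * Real.pi * Y ^ 2 / √n * ((1 + α ^ 2) * (1 + δ ^ 2) * c ^ 2)⁻¹) := by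
        rw [← ENNReal.ofReal_mul hM0, hM, ← sq_abs c]
        congr 1
        field_simp
        norm_num

end CoshSq

section LatticeSums

theorem summable_inv_one_add_int_sq : Summable fun n : ℤ ↦ (1 + (n : ℝ) ^ 2)⁻¹ := by
  refine (Real.summable_one_div_int_pow.mpr one_lt_two).of_norm_bounded_eventually ?_
  filter_upwards [(finite_singleton (0 : ℤ)).compl_mem_cofinite] with n hn
  have : (n : ℝ) ≠ 0 := Int.cast_ne_zero.mpr hn
  rw [Real.norm_of_nonneg (by positivity), one_div]
  gcongr
  exact le_add_of_nonneg_left zero_le_one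

theorem exists_tsum_inv_one_add_shift_sq_le :
    ∃ C : ℝ≥0, ∀ θ : ℝ, ∑' n : ℤ, ENNReal.ofReal (1 + (n + θ) ^ 2)⁻¹ ≤ C := by
  have hsummable : Summable fun n : ℤ ↦ 3 * (1 + (n : ℝ) ^ 2)⁻¹ := by
    exact summable_inv_one_add_int_sq.mul_left 3
  refine ⟨(∑' n : ℤ, 3 * (1 + (n : ℝ) ^ 2)⁻¹).toNNReal, fun θ ↦ ?_⟩
  have hterm : ∀ n : ℤ, (1 + (n + Int.fract θ) ^ 2)⁻¹ ≤ 3 * (1 + (n : ℝ) ^ 2)⁻¹ := fun n ↦ by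
    rw [← div_eq_mul_inv, inv_eq_one_div, div_le_div_iff₀ (by positivity) (by positivity)]
    have hfract : Int.fract θ ^ 2 ≤ 1 := pow_le_one₀ (Int.fract_nonneg θ) (Int.fract_lt_one θ).le
    linarith [sq_nonneg (n + 3 / 2 * Int.fract θ)]
  calc ∑' n : ℤ, ENNReal.ofReal (1 + (n + θ) ^ 2)⁻¹
      = ∑' n : ℤ, ENNReal.ofReal (1 + (n + Int.fract θ) ^ 2)⁻¹ := by
        rw [← (Equiv.subRight ⌊θ⌋).tsum_eq]
        refine tsum_congr fun n ↦ ?_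
        rw [Equiv.subRight_apply, Int.cast_sub, sub_add, ← neg_sub θ, sub_neg_eq_add, Int.fract]
    _ ≤ ∑' n : ℤ, ENNReal.ofReal (3 * (1 + (n : ℝ) ^ 2)⁻¹) :=
        ENNReal.tsum_le_tsum fun n ↦ ENNReal.ofReal_le_ofReal (hterm n)
    _ = ENNReal.ofReal (∑' n : ℤ, 3 * (1 + (n : ℝ) ^ 2)⁻¹) :=
        (ENNReal.ofReal_tsum_of_nonneg (fun n ↦ by positivity) hsummable).symm

theorem exists_tsum_inv_int_sq_le :
    ∃ C : ℝ≥0, ∑' n : ℤ, ENNReal.ofReal ((n : ℝ) ^ 2)⁻¹ ≤ C := by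
  have hsummable := Real.summable_one_div_int_pow.mpr one_lt_two
  simp only [one_div] at hsummable
  exact ⟨_, (ENNReal.ofReal_tsum_of_nonneg (fun n ↦ by positivity) hsummable).ge⟩

theorem specialLinearGroup_ext_entries {g g' : SL(2, ℤ)} (ha : g 0 0 = g' 0 0)
    (hb : g 0 1 = g' 0 1) (hc : g 1 0 = g' 1 0) (hd : g 1 1 = g' 1 1) : g = g' := by
  ext i j
  fin_cases i <;> fin_cases j <;> assumption

theorem injective_entries_of_lower_left_ne_zero :
    Function.Injective fun g : {g : SL(2, ℤ) | g 1 0 ≠ 0} ↦ (g.1 1 0, g.1 0 0, g.1 1 1) := by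
  intro g g' h
  obtain ⟨hc, ha, hd⟩ : g.1 1 0 = g'.1 1 0 ∧ g.1 0 0 = g'.1 0 0 ∧ g.1 1 1 = g'.1 1 1 := by
    simpa only [Prod.mk.injEq] using h
  have hdet := specialLinearGroup_det_entries g.1
  have hdet' := specialLinearGroup_det_entries g'.1
  rw [hc, ha, hd] at hdet
  have hb : (g.1 0 1 : ℝ) = g'.1 0 1 :=
    mul_right_cancel₀ (Int.cast_ne_zero.mpr g'.2) (by linarith)
  exact Subtype.ext (specialLinearGroup_ext_entries ha (Int.cast_injective hb) hc hd)

theorem exists_tsum_lower_left_ne_zero_le :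
    ∃ C : ℝ≥0, ∀ x : ℝ, ∑' g : {g : SL(2, ℤ) | g 1 0 ≠ 0},
      ENNReal.ofReal ((1 + (g.1 0 0 - g.1 1 0 * x) ^ 2) *
        (1 + (g.1 1 0 * x + g.1 1 1) ^ 2) * (g.1 1 0 : ℝ) ^ 2)⁻¹ ≤ C := by
  obtain ⟨A, hA⟩ := exists_tsum_inv_one_add_shift_sq_le
  obtain ⟨Z, hZ⟩ := exists_tsum_inv_int_sq_le
  refine ⟨Z * (A * A), fun x ↦ ?_⟩
  let F : ℤ × ℤ × ℤ → ℝ≥0∞ := fun p ↦ ENNReal.ofReal ((p.1 : ℝ) ^ 2)⁻¹ *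
    (ENNReal.ofReal (1 + (p.2.1 + -(p.1 * x)) ^ 2)⁻¹ *
      ENNReal.ofReal (1 + (p.2.2 + p.1 * x) ^ 2)⁻¹)
  calc ∑' g : {g : SL(2, ℤ) | g 1 0 ≠ 0}, ENNReal.ofReal ((1 + (g.1 0 0 - g.1 1 0 * x) ^ 2) *
        (1 + (g.1 1 0 * x + g.1 1 1) ^ 2) * (g.1 1 0 : ℝ) ^ 2)⁻¹
      = ∑' g : {g : SL(2, ℤ) | g 1 0 ≠ 0}, F (g.1 1 0, g.1 0 0, g.1 1 1) := by
        refine tsum_congr fun g ↦ ?_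
        simp only [F]
        rw [← ENNReal.ofReal_mul (by positivity), ← ENNReal.ofReal_mul (by positivity),
          ← mul_inv, ← mul_inv, ← sub_eq_add_neg, add_comm (g.1 1 1 : ℝ), mul_comm]
    _ ≤ ∑' p, F p :=
        ENNReal.tsum_comp_le_tsum_of_injective injective_entries_of_lower_left_ne_zero F
    _ = ∑' c : ℤ, ENNReal.ofReal ((c : ℝ) ^ 2)⁻¹ *
          ((∑' a : ℤ, ENNReal.ofReal (1 + (a + -(c * x)) ^ 2)⁻¹) *
            ∑' d : ℤ, ENNReal.ofReal (1 + (d + c * x) ^ 2)⁻¹) := by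
        simp only [F, ENNReal.tsum_prod', ENNReal.tsum_mul_left, ENNReal.tsum_mul_right]
    _ ≤ ∑' c : ℤ, ENNReal.ofReal ((c : ℝ) ^ 2)⁻¹ * (A * A) := by
        refine ENNReal.tsum_le_tsum fun c ↦ ?_
        gcongr <;> exact hA _
    _ ≤ (Z * (A * A) : ℝ≥0) := by
        rw [ENNReal.tsum_mul_right]
        push_cast
        gcongr

theorem diag_of_lower_left_eq_zero {g : SL(2, ℤ)} (hc : g 1 0 = 0) :
    (g 0 0 = 1 ∧ g 1 1 = 1) ∨ (g 0 0 = -1 ∧ g 1 1 = -1) := by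
  have h : (g 0 0 * g 1 1 : ℝ) = 1 := by
    simpa [hc] using specialLinearGroup_det_entries g
  exact Int.mul_eq_one_iff_eq_one_or_neg_one.mp (by exact_mod_cast h)

theorem upper_right_ne_zero_of_lower_left_eq_zero {g : SL(2, ℤ)} (hc : g 1 0 = 0) (h1 : g ≠ 1)
    (h2 : g ≠ -1) : g 0 1 ≠ 0 := by
  intro hb
  rcases diag_of_lower_left_eq_zero hc with ⟨ha, hd⟩ | ⟨ha, hd⟩
  · exact h1 (specialLinearGroup_ext_entries (by simp [ha]) (by simp [hb]) (by simp [hc])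
      (by simp [hd]))
  · exact h2 (specialLinearGroup_ext_entries (by simp [ha]) (by simp [hb]) (by simp [hc])
      (by simp [hd]))

theorem injective_entries_of_lower_left_eq_zero :
    Function.Injective fun g : {g : SL(2, ℤ) | g 1 0 = 0} ↦ (decide (g.1 0 0 = 1), g.1 0 1) := by
  intro g g' h
  obtain ⟨ha, hb⟩ : (g.1 0 0 = 1 ↔ g'.1 0 0 = 1) ∧ g.1 0 1 = g'.1 0 1 := by
    simpa only [Prod.mk.injEq, decide_eq_decide] using h
  have hdiag := diag_of_lower_left_eq_zero g.2
  have hdiag' := diag_of_lower_left_eq_zero g'.2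
  exact Subtype.ext (specialLinearGroup_ext_entries (by omega) hb (g.2.trans g'.2.symm) (by omega))

-- The matrices `±1` contribute zero, since `0⁻¹ = 0`.
theorem exists_tsum_lower_left_eq_zero_le :
    ∃ C : ℝ≥0, ∑' g : {g : SL(2, ℤ) | g 1 0 = 0},
      ENNReal.ofReal ((g.1 0 1 : ℝ) ^ 2)⁻¹ ≤ C := by
  obtain ⟨Z, hZ⟩ := exists_tsum_inv_int_sq_le
  refine ⟨2 * Z, ?_⟩
  calc ∑' g : {g : SL(2, ℤ) | g 1 0 = 0}, ENNReal.ofReal ((g.1 0 1 : ℝ) ^ 2)⁻¹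
      ≤ ∑' p : Bool × ℤ, ENNReal.ofReal ((p.2 : ℝ) ^ 2)⁻¹ :=
        ENNReal.tsum_comp_le_tsum_of_injective injective_entries_of_lower_left_eq_zero
          fun p : Bool × ℤ ↦ ENNReal.ofReal ((p.2 : ℝ) ^ 2)⁻¹
    _ = 2 * ∑' n : ℤ, ENNReal.ofReal ((n : ℝ) ^ 2)⁻¹ := by
        rw [ENNReal.tsum_prod', tsum_bool, two_mul]
    _ ≤ (2 * Z : ℝ≥0) := by
        push_cast
        gcongr

end LatticeSums

section Displacement

theorem one_le_log_of_three_le {k : ℝ} (hk : 3 ≤ k) : 1 ≤ Real.log k := by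
  rw [Real.le_log_iff_exp_le (by linarith)]
  linarith [Real.exp_one_lt_d9]

theorem eight_mul_log_le {k : ℝ} (hk : 256 ≤ k) : 8 * Real.log k ≤ k := by
  have hsqrt : 16 ≤ √k := Real.le_sqrt_of_sq_le (by linarith)
  have hlog : Real.log k = 2 * Real.log √k := by
    rw [Real.log_sqrt (by linarith)]
    ring
  calc 8 * Real.log k ≤ 16 * √k := by linarith [Real.log_le_self (Real.sqrt_nonneg k)]
    _ ≤ √k * √k := by gcongr
    _ = k := Real.mul_self_sqrt (by linarith)

theorem mul_sqrt_le_one_add_pow {k u : ℝ} {n : ℕ} (hk : 256 ≤ k) (hn : 3 / 8 * k ≤ n)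
    (hu : 6 * Real.log k / k ≤ u) : k * √k ≤ (1 + u) ^ n := by
  have hk0 : 0 < k := by linarith
  have hlog : 0 < Real.log k := Real.log_pos (by linarith)
  set v := 6 * Real.log k / k with hv
  have hv0 : 0 < v := by positivity
  have hv1 : v ≤ 1 := (div_le_one hk0).mpr (by linarith [eight_mul_log_le hk])
  have hlog_add : 2 * v / 3 ≤ Real.log (1 + v) :=
    calc 2 * v / 3 ≤ 2 * v / (v + 2) := by
          gcongr
          linarith
      _ ≤ Real.log (1 + v) := Real.le_log_one_add_of_nonneg hv0.le
  have hlog_le : Real.log (k * √k) ≤ Real.log ((1 + v) ^ n) := by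
    rw [Real.log_pow, Real.log_mul (by positivity) (by positivity), Real.log_sqrt hk0.le]
    calc Real.log k + Real.log k / 2 = 3 / 8 * k * (2 * v / 3) := by
          rw [hv]
          field_simp
          norm_num
      _ ≤ n * Real.log (1 + v) := by gcongr
  calc k * √k ≤ (1 + v) ^ n := (Real.log_le_log_iff (by positivity) (by positivity)).mp hlog_le
    _ ≤ (1 + u) ^ n := by gcongr

theorem inv_one_add_sq_div_pow_mul_le {m : ℕ} (hm : 128 ≤ m) {b y : ℝ} (hb : 1 ≤ b ^ 2)
    (hy : 0 < y) (hym : y ^ 2 ≤ 2 * m / (24 * Real.log (2 * m))) :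
    ((1 + b ^ 2 / (4 * y ^ 2)) ^ m * y)⁻¹ ≤ 4 * y / (2 * m * √(2 * m)) * (b ^ 2)⁻¹ := by
  have hm' : (128 : ℝ) ≤ m := by exact_mod_cast hm
  obtain ⟨n, rfl⟩ := Nat.exists_eq_add_of_le' (show 1 ≤ m by omega)
  set k : ℝ := 2 * (n + 1 : ℕ) with hk
  push_cast at hk hm'
  have hlog : 0 < Real.log k := Real.log_pos (by linarith)
  have hu : 6 * Real.log k / k ≤ b ^ 2 / (4 * y ^ 2) := by
    rw [le_div_iff₀ (by positivity)] at hym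
    rw [div_le_div_iff₀ (by linarith) (by positivity)]
    calc 6 * Real.log k * (4 * y ^ 2) = y ^ 2 * (24 * Real.log k) := by ring
      _ ≤ 1 * k := by linarith
      _ ≤ b ^ 2 * k := by gcongr
  have hpow : k * √k * (b ^ 2 / (4 * y ^ 2)) ≤ (1 + b ^ 2 / (4 * y ^ 2)) ^ (n + 1) := by
    rw [pow_succ _ n]
    gcongr
    · exact mul_sqrt_le_one_add_pow (by linarith) (by linarith) hu
    · exact le_add_of_nonneg_left zero_le_one
  have : 0 < b ^ 2 := by linarith
  calc ((1 + b ^ 2 / (4 * y ^ 2)) ^ (n + 1) * y)⁻¹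
      ≤ (k * √k * (b ^ 2 / (4 * y ^ 2)) * y)⁻¹ := by gcongr
    _ = 4 * y / (k * √k) * (b ^ 2)⁻¹ := by field_simp

/-- The value of `cosh²` at half the hyperbolic distance from `x + iy` to its image under `g`,
obtained by conjugating `g` with the translation by `x`. -/
noncomputable def displacement (g : SL(2, ℤ)) (x y : ℝ) : ℝ :=
  coshSq (g 0 0 - g 1 0 * x) ((g 0 0 - g 1 0 * x) * x + (g 0 1 - g 1 1 * x)) (g 1 0)
    (g 1 0 * x + g 1 1) y

theorem displacement_det (g : SL(2, ℤ)) (x : ℝ) :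
    (g 0 0 - g 1 0 * x : ℝ) * (g 1 0 * x + g 1 1) -
      ((g 0 0 - g 1 0 * x) * x + (g 0 1 - g 1 1 * x)) * g 1 0 = 1 := by
  linear_combination specialLinearGroup_det_entries g

theorem norm_kernelDenom_diag_sq (g : SL(2, ℤ)) (z : ℍ) :
    ‖kernelDenom g z z‖ ^ 2 = (2 * z.im) ^ 2 * displacement g z.re z.im := by
  have := z.im_pos
  rw [norm_kernelDenom_sq, displacement, coshSq]
  simp only [UpperHalfPlane.coe_re, UpperHalfPlane.coe_im]
  field_simp
  ring

theorem measurable_displacement (g : SL(2, ℤ)) (x : ℝ) : Measurable (displacement g x) := by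
  unfold displacement coshSq
  fun_prop

theorem displacement_of_lower_left_eq_zero {g : SL(2, ℤ)} (hg : g 1 0 = 0) (x : ℝ) {y : ℝ}
    (hy : 0 < y) : displacement g x y = 1 + (g 0 1 : ℝ) ^ 2 / (4 * y ^ 2) := by
  rw [displacement, coshSq, hg]
  rcases diag_of_lower_left_eq_zero hg with ⟨ha, hd⟩ | ⟨ha, hd⟩ <;>
  · rw [ha, hd]
    field_simp
    push_cast
    ring

theorem setLIntegral_displacement_of_lower_left_ne_zero {m : ℕ} (hm : 6 ≤ m) (x : ℝ)
    {Y : ℝ} (hY : 0 < Y) (T : ℝ) {g : SL(2, ℤ)} (hg : g 1 0 ≠ 0) :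
    ∫⁻ y in Ioo Y⁻¹ T, ENNReal.ofReal (displacement g x y ^ m * y)⁻¹ ≤
      ENNReal.ofReal (128 * Real.pi * Y ^ 2 / √(2 * m)) *
        ENNReal.ofReal ((1 + (g 0 0 - g 1 0 * x) ^ 2) * (1 + (g 1 0 * x + g 1 1) ^ 2) *
          (g 1 0 : ℝ) ^ 2)⁻¹ := by
  obtain ⟨n, rfl⟩ := Nat.exists_eq_add_of_le' (show 3 ≤ m by omega)
  have hn : (3 : ℝ) ≤ n := by exact_mod_cast (show 3 ≤ n by omega)
  have hsqrt : √(2 * (n + 3 : ℕ)) ≤ 2 * √n := by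
    refine (Real.sqrt_le_left (by positivity)).mpr ?_
    rw [mul_pow, Real.sq_sqrt n.cast_nonneg]
    push_cast
    linarith
  refine (setLIntegral_inv_coshSq_pow_mul_le (displacement_det g x) (Int.cast_ne_zero.mpr hg)
    (by omega) hY T).trans ?_
  rw [← ENNReal.ofReal_mul (by positivity)]
  refine ENNReal.ofReal_le_ofReal (mul_le_mul_of_nonneg_right ?_ (by positivity))
  rw [div_le_div_iff₀ (by positivity) (by positivity)]
  calc 64 * Real.pi * Y ^ 2 * √(2 * (n + 3 : ℕ)) ≤ 64 * Real.pi * Y ^ 2 * (2 * √n) := by gcongr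
    _ = 128 * Real.pi * Y ^ 2 * √n := by ring

theorem mul_sq_le_of_sq_le_div_log {k T : ℝ} (hk : 3 ≤ k) (hT : T ^ 2 ≤ k / (24 * Real.log k)) :
    24 * T ^ 2 ≤ k := by
  have hlog := one_le_log_of_three_le hk
  rw [le_div_iff₀ (by positivity)] at hT
  nlinarith [sq_nonneg T]

theorem inv_displacement_pow_mul_le_of_lower_left_eq_zero {m : ℕ} (hm : 128 ≤ m) (x : ℝ) {y : ℝ}
    (hy : 0 < y) (hy' : y ^ 2 ≤ 2 * m / (24 * Real.log (2 * m))) {g : SL(2, ℤ)}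
    (hg : g 1 0 = 0) (h1 : g ≠ 1) (h2 : g ≠ -1) :
    (displacement g x y ^ m * y)⁻¹ ≤ 4 * y / (2 * m * √(2 * m)) * ((g 0 1 : ℝ) ^ 2)⁻¹ := by
  have hb : 1 ≤ (g 0 1 : ℝ) ^ 2 := by
    exact_mod_cast sq_pos_of_ne_zero (upper_right_ne_zero_of_lower_left_eq_zero hg h1 h2)
  rw [displacement_of_lower_left_eq_zero hg x hy]
  exact inv_one_add_sq_div_pow_mul_le hm hb hy hy'

theorem setLIntegral_displacement_of_lower_left_eq_zero {m : ℕ} (hm : 128 ≤ m) (x : ℝ)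
    {Y T : ℝ} (hY : 0 < Y) (hT : T ^ 2 ≤ 2 * m / (24 * Real.log (2 * m))) {g : SL(2, ℤ)}
    (hg : g 1 0 = 0) (h1 : g ≠ 1) (h2 : g ≠ -1) :
    ∫⁻ y in Ioo Y⁻¹ T, ENNReal.ofReal (displacement g x y ^ m * y)⁻¹ ≤
      ENNReal.ofReal (1 / √(2 * m)) * ENNReal.ofReal ((g 0 1 : ℝ) ^ 2)⁻¹ := by
  have hY' : 0 < Y⁻¹ := inv_pos.mpr hY
  have hm' : (128 : ℝ) ≤ m := by exact_mod_cast hm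
  set k : ℝ := 2 * m
  have hk0 : 0 < k := by positivity
  set M := 4 * |T| / (k * √k) * ((g 0 1 : ℝ) ^ 2)⁻¹ with hM
  have hpointwise : ∀ y ∈ Ioo Y⁻¹ T, (displacement g x y ^ m * y)⁻¹ ≤ M := fun y hy ↦ by
    have hy0 : 0 < y := hY'.trans hy.1
    have hyT : y ^ 2 ≤ T ^ 2 := pow_le_pow_left₀ hy0.le hy.2.le 2
    refine (inv_displacement_pow_mul_le_of_lower_left_eq_zero hm x hy0 (hyT.trans hT)
      hg h1 h2).trans ?_
    rw [hM]
    gcongr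
    exact hy.2.le.trans (le_abs_self T)
  have hTk : 4 * |T| * |T| ≤ k := by
    rw [mul_assoc, abs_mul_abs_self, ← sq]
    linarith [mul_sq_le_of_sq_le_div_log (by linarith) hT, sq_nonneg T]
  calc ∫⁻ y in Ioo Y⁻¹ T, ENNReal.ofReal (displacement g x y ^ m * y)⁻¹
      ≤ ∫⁻ _ in Ioo Y⁻¹ T, ENNReal.ofReal M :=
        setLIntegral_mono' measurableSet_Ioo fun y hy ↦
          ENNReal.ofReal_le_ofReal (hpointwise y hy)
    _ = ENNReal.ofReal M * ENNReal.ofReal (T - Y⁻¹) := by rw [setLIntegral_const, Real.volume_Ioo]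
    _ ≤ ENNReal.ofReal M * ENNReal.ofReal |T| := by
        gcongr
        linarith [le_abs_self T]
    _ ≤ ENNReal.ofReal (1 / √k) * ENNReal.ofReal ((g 0 1 : ℝ) ^ 2)⁻¹ := by
        rw [← ENNReal.ofReal_mul (by positivity), ← ENNReal.ofReal_mul (by positivity)]
        refine ENNReal.ofReal_le_ofReal ?_
        calc M * |T| = 4 * |T| * |T| / (k * √k) * ((g 0 1 : ℝ) ^ 2)⁻¹ := by ring
          _ ≤ k / (k * √k) * ((g 0 1 : ℝ) ^ 2)⁻¹ := by gcongr
          _ = 1 / √k * ((g 0 1 : ℝ) ^ 2)⁻¹ := by rw [div_mul_cancel_left₀ hk0.ne', one_div]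

theorem exists_tsum_setLIntegral_displacement_lower_left_ne_zero_le : ∃ C : ℝ≥0,
    ∀ (m : ℕ) (x Y T : ℝ), 6 ≤ m → 0 < Y →
      ∑' g : {g : SL(2, ℤ) | g 1 0 ≠ 0},
        ∫⁻ y in Ioo Y⁻¹ T, ENNReal.ofReal (displacement g x y ^ m * y)⁻¹ ≤
      ENNReal.ofReal (C * (Y ^ 2 / √(2 * m))) := by
  obtain ⟨C, hC⟩ := exists_tsum_lower_left_ne_zero_le
  refine ⟨128 * NNReal.pi * C, fun m x Y T hm hY ↦ ?_⟩
  calc ∑' g : {g : SL(2, ℤ) | g 1 0 ≠ 0},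
        ∫⁻ y in Ioo Y⁻¹ T, ENNReal.ofReal (displacement g x y ^ m * y)⁻¹
      ≤ ENNReal.ofReal (128 * Real.pi * Y ^ 2 / √(2 * m)) * C := by
        refine (ENNReal.tsum_le_tsum fun g ↦
          setLIntegral_displacement_of_lower_left_ne_zero hm x hY T g.2).trans ?_
        rw [ENNReal.tsum_mul_left]
        gcongr
        exact hC x
    _ = ENNReal.ofReal ((128 * NNReal.pi * C : ℝ≥0) * (Y ^ 2 / √(2 * m))) := by
        rw [← ENNReal.ofReal_coe_nnreal (p := C), ← ENNReal.ofReal_mul (by positivity)]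
        push_cast
        rw [NNReal.coe_real_pi]
        congr 1
        ring

theorem exists_tsum_setLIntegral_displacement_lower_left_eq_zero_le : ∃ C : ℝ≥0,
    ∀ (m : ℕ) (x Y T : ℝ), 128 ≤ m → 0 < Y → T ^ 2 ≤ 2 * m / (24 * Real.log (2 * m)) →
      ∑' g : {g : SL(2, ℤ) | g 1 0 = 0 ∧ g ≠ 1 ∧ g ≠ -1},
        ∫⁻ y in Ioo Y⁻¹ T, ENNReal.ofReal (displacement g x y ^ m * y)⁻¹ ≤
      ENNReal.ofReal (C * (1 / √(2 * m))) := by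
  obtain ⟨C, hC⟩ := exists_tsum_lower_left_eq_zero_le
  refine ⟨C, fun m x Y T hm hY hT ↦ ?_⟩
  calc ∑' g : {g : SL(2, ℤ) | g 1 0 = 0 ∧ g ≠ 1 ∧ g ≠ -1},
        ∫⁻ y in Ioo Y⁻¹ T, ENNReal.ofReal (displacement g x y ^ m * y)⁻¹
      ≤ ENNReal.ofReal (1 / √(2 * m)) * C := by
        refine (ENNReal.tsum_le_tsum fun g ↦
          setLIntegral_displacement_of_lower_left_eq_zero hm x hY hT g.2.1 g.2.2.1 g.2.2.2).trans ?_
        rw [ENNReal.tsum_mul_left]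
        gcongr
        exact (ENNReal.tsum_mono_subtype (fun g : SL(2, ℤ) ↦ ENNReal.ofReal ((g 0 1 : ℝ) ^ 2)⁻¹)
          fun g hg ↦ hg.1).trans hC
    _ = ENNReal.ofReal (C * (1 / √(2 * m))) := by
        rw [← ENNReal.ofReal_coe_nnreal (p := C), ← ENNReal.ofReal_mul (by positivity), mul_comm]

theorem notMem_pair_one_neg_one_subset :
    {g : SL(2, ℤ) | g ∉ ({1, -1} : Finset SL(2, ℤ))} ⊆
      {g | g 1 0 ≠ 0} ∪ {g | g 1 0 = 0 ∧ g ≠ 1 ∧ g ≠ -1} := fun g hg ↦ by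
  simp only [mem_ofPred_eq, Finset.mem_insert, Finset.mem_singleton, not_or] at hg
  by_cases h : g 1 0 = 0
  · exact .inr ⟨h, hg⟩
  · exact .inl h

theorem exists_setLIntegral_tsum_displacement_le : ∃ C : ℝ≥0, ∀ (m : ℕ) (x Y T : ℝ), 128 ≤ m →
    1 ≤ Y → T ^ 2 ≤ 2 * m / (24 * Real.log (2 * m)) →
      ∫⁻ y in Ioo Y⁻¹ T, ∑' g : {g : SL(2, ℤ) // g ∉ ({1, -1} : Finset SL(2, ℤ))},
        ENNReal.ofReal (displacement g x y ^ m * y)⁻¹ ≤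
      ENNReal.ofReal (C * (Y ^ 2 / √(2 * m))) := by
  obtain ⟨C₁, hC₁⟩ := exists_tsum_setLIntegral_displacement_lower_left_ne_zero_le
  obtain ⟨C₂, hC₂⟩ := exists_tsum_setLIntegral_displacement_lower_left_eq_zero_le
  refine ⟨C₁ + C₂, fun m x Y T hm hY hT ↦ ?_⟩
  have hY0 : 0 < Y := by linarith
  let I : SL(2, ℤ) → ℝ≥0∞ := fun g ↦
    ∫⁻ y in Ioo Y⁻¹ T, ENNReal.ofReal (displacement g x y ^ m * y)⁻¹
  have hmeas : ∀ g : {g : SL(2, ℤ) // g ∉ ({1, -1} : Finset SL(2, ℤ))}, AEMeasurable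
      (fun y ↦ ENNReal.ofReal (displacement g x y ^ m * y)⁻¹) (volume.restrict (Ioo Y⁻¹ T)) :=
    fun g ↦ (((measurable_displacement g x).pow_const m).mul
      measurable_id).inv.ennreal_ofReal.aemeasurable
  rw [lintegral_tsum hmeas]
  calc ∑' g : {g : SL(2, ℤ) | g ∉ ({1, -1} : Finset SL(2, ℤ))}, I g
      ≤ ∑' g : ({g | g 1 0 ≠ 0} ∪ {g | g 1 0 = 0 ∧ g ≠ 1 ∧ g ≠ -1} : Set SL(2, ℤ)), I g :=
        ENNReal.tsum_mono_subtype I notMem_pair_one_neg_one_subset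
    _ ≤ ∑' g : {g : SL(2, ℤ) | g 1 0 ≠ 0}, I g +
        ∑' g : {g : SL(2, ℤ) | g 1 0 = 0 ∧ g ≠ 1 ∧ g ≠ -1}, I g := ENNReal.tsum_union_le I _ _
    _ ≤ ENNReal.ofReal (C₁ * (Y ^ 2 / √(2 * m))) + ENNReal.ofReal (C₂ * (1 / √(2 * m))) :=
        add_le_add (hC₁ m x Y T (by omega) hY0) (hC₂ m x Y T hm hY0 hT)
    _ ≤ ENNReal.ofReal (C₁ * (Y ^ 2 / √(2 * m))) + ENNReal.ofReal (C₂ * (Y ^ 2 / √(2 * m))) := by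
        gcongr
        exact one_le_pow₀ hY
    _ = ENNReal.ofReal ((C₁ + C₂ : ℝ≥0) * (Y ^ 2 / √(2 * m))) := by
        rw [← ENNReal.ofReal_add (by positivity) (by positivity), ← add_mul, NNReal.coe_add]

end Displacement

section AveragedDensity

variable {ι : Type*} {k m : ℕ}

theorem card_basis_cuspForm_bounds [Fintype ι] (hk : 3 ≤ k) (heven : Even k)
    (B : Module.Basis ι ℂ (CuspForm 𝒮ℒ (k : ℤ))) :
    12 * Fintype.card ι ≤ k ∧ k ≤ 12 * Fintype.card ι + 23 := by
  have hrank := ModularForm.rank_eq_one_add_rank_cuspForm hk heven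
  rw [ModularForm.dimension_level_one k heven, rank_eq_card_basis B] at hrank
  split_ifs at hrank
  · have hcard : k / 12 = 1 + Fintype.card ι := by exact_mod_cast hrank
    omega
  · have hcard : k / 12 + 1 = 1 + Fintype.card ι := by exact_mod_cast hrank
    omega

theorem abs_div_sub_three_div_pi_le {k N Q : ℝ} (hk : 46 ≤ k) (hN : 12 * N ≤ k)
    (hN' : k ≤ 12 * N + 23) :
    |Q / N - 3 / Real.pi| ≤ 46 / k + |8 * Real.pi / (k - 1) * Q - 2| := by
  have hN0 : 0 < N := by linarith
  have hk1 : 0 < k - 1 := by linarith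
  have hπN : 3 * N ≤ Real.pi * N := by
    gcongr
    exact Real.pi_gt_three.le
  have hsplit : Q / N - 3 / Real.pi = (k - 1 - 12 * N) / (4 * Real.pi * N) +
      (k - 1) / (8 * Real.pi * N) * (8 * Real.pi / (k - 1) * Q - 2) := by
    field_simp
    ring
  have hcard : |(k - 1 - 12 * N) / (4 * Real.pi * N)| ≤ 46 / k := by
    rw [abs_div, abs_of_pos (by positivity : 0 < 4 * Real.pi * N)]
    calc |k - 1 - 12 * N| / (4 * Real.pi * N) ≤ 23 / (k / 2) := by
          gcongr
          · exact abs_le.mpr ⟨by linarith, by linarith⟩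
          · linarith
      _ = 46 / k := by
          field_simp
          norm_num
  have hcoeff : (k - 1) / (8 * Real.pi * N) ≤ 1 := by
    rw [div_le_one (by positivity)]
    linarith
  calc |Q / N - 3 / Real.pi|
      ≤ |(k - 1 - 12 * N) / (4 * Real.pi * N)| +
          |(k - 1) / (8 * Real.pi * N) * (8 * Real.pi / (k - 1) * Q - 2)| := by
        rw [hsplit]
        exact abs_add_le _ _
    _ ≤ 46 / k + 1 * |8 * Real.pi / (k - 1) * Q - 2| := by
        rw [abs_mul, abs_of_nonneg (by positivity : 0 ≤ (k - 1) / (8 * Real.pi * N))]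
        gcongr
    _ = 46 / k + |8 * Real.pi / (k - 1) * Q - 2| := by rw [one_mul]

theorem kernelDenom_one_diag (w : ℍ) : kernelDenom 1 w w = 2 * Complex.I * w.im := by
  rw [← UpperHalfPlane.coe_im, ← sub_conj_eq_two_mul_I_mul_im]
  simp [kernelDenom]

theorem kernelDenom_neg_one_diag (w : ℍ) : kernelDenom (-1) w w = -(2 * Complex.I * w.im) := by
  rw [← kernelDenom_one_diag]
  simp [kernelDenom, neg_add_eq_sub]

theorem norm_im_pow_mul_kernel_term (m : ℕ) (w : ℍ) (g : SL(2, ℤ)) :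
    ‖(w.im : ℂ) ^ (2 * m) * (2 * Complex.I / kernelDenom g w w) ^ (2 * m)‖ =
      (displacement g w.re w.im ^ m)⁻¹ := by
  have hw := w.im_pos
  have : 0 < ‖kernelDenom g w w‖ := norm_pos_iff.mpr (kernelDenom_ne_zero g hw hw)
  rw [← mul_pow, norm_pow, pow_mul, ← inv_pow]
  congr 1
  have hdiag := norm_kernelDenom_diag_sq g w
  have hdisp : displacement g w.re w.im ≠ 0 := by
    rintro h
    rw [h, mul_zero] at hdiag
    exact this.ne' (pow_eq_zero_iff two_ne_zero |>.mp hdiag)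
  rw [norm_mul, norm_div, norm_mul, Complex.norm_I, Complex.norm_real,
    Real.norm_of_nonneg hw.le, Complex.norm_ofNat, mul_one, mul_pow, div_pow, hdiag]
  field_simp

theorem summable_inv_displacement_pow (hm : 3 ≤ m) (w : ℍ) :
    Summable fun g : SL(2, ℤ) ↦ (displacement g w.re w.im ^ m)⁻¹ := by
  simp only [← norm_im_pow_mul_kernel_term, norm_mul]
  exact (summable_norm_kernel_term w w (by omega)).mul_left _

theorem im_pow_mul_kernelSeries_eq_two_add (hm : 3 ≤ m) (w : ℍ) :
    (w.im : ℂ) ^ (2 * m) * kernelSeries (2 * m) w w =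
      2 + ∑' g : {g : SL(2, ℤ) // g ∉ ({1, -1} : Finset SL(2, ℤ))},
        (w.im : ℂ) ^ (2 * m) * (2 * Complex.I / kernelDenom g w w) ^ (2 * m) := by
  have hsummable : Summable fun g : SL(2, ℤ) ↦
      (w.im : ℂ) ^ (2 * m) * (2 * Complex.I / kernelDenom g w w) ^ (2 * m) := by
    refine Summable.of_norm ?_
    simpa only [norm_im_pow_mul_kernel_term] using summable_inv_displacement_pow hm w
  have hne : (1 : SL(2, ℤ)) ≠ -1 := fun h ↦ by
    simpa using congrArg (fun g : SL(2, ℤ) ↦ g 0 0) h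
  have hy : (w.im : ℂ) ≠ 0 := Complex.ofReal_ne_zero.mpr w.im_ne_zero
  have hI := Complex.I_ne_zero
  have hone : (w.im : ℂ) * (2 * Complex.I / kernelDenom 1 w w) = 1 := by
    rw [kernelDenom_one_diag]
    field_simp
  have hneg_one : (w.im : ℂ) * (2 * Complex.I / kernelDenom (-1) w w) = -1 := by
    rw [kernelDenom_neg_one_diag]
    field_simp
  rw [kernelSeries, ← tsum_mul_left, ← hsummable.sum_add_tsum_subtype_compl {1, -1},
    Finset.sum_pair hne, ← mul_pow, ← mul_pow, hone, hneg_one, one_pow,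
    (even_two_mul m).neg_one_pow, one_add_one_eq_two]

theorem norm_im_pow_mul_kernelSeries_sub_two_le (hm : 3 ≤ m) (w : ℍ) :
    ‖(w.im : ℂ) ^ (2 * m) * kernelSeries (2 * m) w w - 2‖ ≤
      ∑' g : {g : SL(2, ℤ) // g ∉ ({1, -1} : Finset SL(2, ℤ))},
        (displacement g w.re w.im ^ m)⁻¹ := by
  rw [im_pow_mul_kernelSeries_eq_two_add hm, add_sub_cancel_left]
  exact tsum_of_norm_bounded ((summable_inv_displacement_pow hm w).subtype _).hasSum fun g ↦
    (norm_im_pow_mul_kernel_term m w g).le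

variable [Fintype ι]

theorem averagedDensity_re_im (B : Module.Basis ι ℂ (CuspForm 𝒮ℒ (k : ℤ))) (w : ℍ) :
    averagedDensity B w.re w.im = w.im ^ k * (∑ i, ‖B i w‖ ^ 2) / Fintype.card ι := by
  rw [averagedDensity, UpperHalfPlane.re_add_im, UpperHalfPlane.ofComplex_apply,
    ← Finset.mul_sum, inv_mul_eq_div]

theorem kernelSeries_diag_eq_sum_norm_sq {B : Module.Basis ι ℂ (CuspForm 𝒮ℒ (k : ℤ))}
    (hk : 7 ≤ k) (hB : IsPeterssonOrthonormal B) (w : ℍ) :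
    kernelSeries k w w = (8 * Real.pi / (k - 1) * ∑ i, ‖B i w‖ ^ 2 : ℝ) := by
  rw [kernelSeries_eq_sum hk hB]
  push_cast
  simp only [Complex.conj_mul']

theorem abs_averagedDensity_sub_three_div_pi_le (hm : 23 ≤ m)
    {B : Module.Basis ι ℂ (CuspForm 𝒮ℒ ((2 * m : ℕ) : ℤ))} (hB : IsPeterssonOrthonormal B)
    (w : ℍ) :
    |averagedDensity B w.re w.im - 3 / Real.pi| ≤ 46 / (2 * m) +
      ∑' g : {g : SL(2, ℤ) // g ∉ ({1, -1} : Finset SL(2, ℤ))},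
        (displacement g w.re w.im ^ m)⁻¹ := by
  obtain ⟨hlower, hupper⟩ := card_basis_cuspForm_bounds (by omega) (even_two_mul m) B
  have hkernel := norm_im_pow_mul_kernelSeries_sub_two_le (show 3 ≤ m by omega) w
  have hnorm : ‖(w.im : ℂ) ^ (2 * m) * kernelSeries (2 * m) w w - 2‖ =
      |8 * Real.pi / (2 * m - 1) * (w.im ^ (2 * m) * ∑ i, ‖B i w‖ ^ 2) - 2| := by
    rw [kernelSeries_diag_eq_sum_norm_sq (by omega) hB, ← Real.norm_eq_abs, ← Complex.norm_real]
    push_cast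
    congr 2
    ring
  rw [hnorm] at hkernel
  rw [averagedDensity_re_im]
  refine (abs_div_sub_three_div_pi_le (k := 2 * m) ?_ ?_ ?_).trans
    (add_le_add_right hkernel _)
  · exact_mod_cast (show 46 ≤ 2 * m by omega)
  · exact_mod_cast hlower
  · exact_mod_cast hupper

theorem ofReal_abs_inv_mul_averagedDensity_sub_le (hm : 23 ≤ m)
    {B : Module.Basis ι ℂ (CuspForm 𝒮ℒ ((2 * m : ℕ) : ℤ))} (hB : IsPeterssonOrthonormal B)
    (x : ℝ) {y : ℝ} (hy : 0 < y) :
    ENNReal.ofReal |y⁻¹ * (averagedDensity B x y - 3 / Real.pi)| ≤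
      ENNReal.ofReal (46 / (2 * m) * y⁻¹) +
        ∑' g : {g : SL(2, ℤ) // g ∉ ({1, -1} : Finset SL(2, ℤ))},
          ENNReal.ofReal (displacement g x y ^ m * y)⁻¹ := by
  let w : ℍ := ⟨⟨x, y⟩, hy⟩
  have hnonneg (g : SL(2, ℤ)) : 0 ≤ (displacement g x y ^ m)⁻¹ * y⁻¹ := by
    unfold displacement coshSq
    positivity
  have hsummable : Summable fun g : {g : SL(2, ℤ) // g ∉ ({1, -1} : Finset SL(2, ℤ))} ↦
      (displacement g x y ^ m)⁻¹ :=
    (summable_inv_displacement_pow (by omega) w).subtype _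
  have hsum_nonneg : 0 ≤ (∑' g : {g : SL(2, ℤ) // g ∉ ({1, -1} : Finset SL(2, ℤ))},
      (displacement g x y ^ m)⁻¹) * y⁻¹ := by
    rw [← tsum_mul_right]
    exact tsum_nonneg fun g ↦ hnonneg g
  have hsum : ENNReal.ofReal ((∑' g : {g : SL(2, ℤ) // g ∉ ({1, -1} : Finset SL(2, ℤ))},
      (displacement g x y ^ m)⁻¹) * y⁻¹) =
      ∑' g : {g : SL(2, ℤ) // g ∉ ({1, -1} : Finset SL(2, ℤ))},
        ENNReal.ofReal ((displacement g x y ^ m)⁻¹ * y⁻¹) := by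
    rw [← tsum_mul_right]
    exact ENNReal.ofReal_tsum_of_nonneg (fun g ↦ hnonneg g) (hsummable.mul_right _)
  simp only [mul_inv]
  rw [← hsum, ← ENNReal.ofReal_add (by positivity) hsum_nonneg, ← add_mul, abs_mul,
    abs_of_pos (inv_pos.mpr hy), mul_comm]
  gcongr
  exact abs_averagedDensity_sub_three_div_pi_le hm hB w

theorem setLIntegral_averagedDensity_sub_le_add (hm : 23 ≤ m)
    {B : Module.Basis ι ℂ (CuspForm 𝒮ℒ ((2 * m : ℕ) : ℤ))} (hB : IsPeterssonOrthonormal B)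
    (x : ℝ) {Y : ℝ} (hY : 0 < Y) (T : ℝ) :
    ∫⁻ y in Ioo Y⁻¹ T, ENNReal.ofReal |y⁻¹ * (averagedDensity B x y - 3 / Real.pi)| ≤
      ENNReal.ofReal (46 / (2 * m) * Y) * ENNReal.ofReal (T - Y⁻¹) + ∫⁻ y in Ioo Y⁻¹ T,
        ∑' g : {g : SL(2, ℤ) // g ∉ ({1, -1} : Finset SL(2, ℤ))},
          ENNReal.ofReal (displacement g x y ^ m * y)⁻¹ := by
  rw [← Real.volume_Ioo, ← setLIntegral_const, ← lintegral_add_left measurable_const]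
  refine setLIntegral_mono' measurableSet_Ioo fun y hy ↦ ?_
  have hy0 : 0 < y := (inv_pos.mpr hY).trans hy.1
  refine (ofReal_abs_inv_mul_averagedDensity_sub_le hm hB x hy0).trans ?_
  gcongr
  exact inv_le_of_inv_le₀ hY hy.1.le

theorem exists_setLIntegral_averagedDensity_sub_le : ∃ C : ℝ≥0, 0 < C ∧ ∀ (m : ℕ) (x Y T : ℝ),
    128 ≤ m → 1 ≤ Y → T ^ 2 ≤ 2 * m / (24 * Real.log (2 * m)) →
    ∀ (ι : Type*) [Fintype ι] (B : Module.Basis ι ℂ (CuspForm 𝒮ℒ ((2 * m : ℕ) : ℤ))),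
      IsPeterssonOrthonormal B →
    ∫⁻ y in Ioo Y⁻¹ T, ENNReal.ofReal |y⁻¹ * (averagedDensity B x y - 3 / Real.pi)| ≤
      ENNReal.ofReal (C * (Y ^ 2 / √(2 * m))) := by
  obtain ⟨C, hC⟩ := exists_setLIntegral_tsum_displacement_le
  refine ⟨46 + C, by positivity, fun m x Y T hm hY hT ι _ B hB ↦ ?_⟩
  have hY0 : 0 < Y := by linarith
  have hm' : (128 : ℝ) ≤ m := by exact_mod_cast hm
  have hdisp := hC m x Y T hm hY hT
  set k : ℝ := 2 * m
  have : 0 < k := by positivity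
  have hTk : T ≤ √k := by
    refine Real.le_sqrt_of_sq_le ?_
    linarith [mul_sq_le_of_sq_le_div_log (show 3 ≤ k by linarith) hT, sq_nonneg T]
  calc ∫⁻ y in Ioo Y⁻¹ T, ENNReal.ofReal |y⁻¹ * (averagedDensity B x y - 3 / Real.pi)|
      ≤ ENNReal.ofReal (46 / k * Y) * ENNReal.ofReal (T - Y⁻¹) + ∫⁻ y in Ioo Y⁻¹ T,
          ∑' g : {g : SL(2, ℤ) // g ∉ ({1, -1} : Finset SL(2, ℤ))},
            ENNReal.ofReal (displacement g x y ^ m * y)⁻¹ :=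
        setLIntegral_averagedDensity_sub_le_add (by omega) hB x hY0 T
    _ ≤ ENNReal.ofReal (46 / k * Y) * ENNReal.ofReal √k +
          ENNReal.ofReal (C * (Y ^ 2 / √k)) := by
        gcongr
        linarith [inv_pos.mpr hY0]
    _ = ENNReal.ofReal (46 * (Y / √k) + C * (Y ^ 2 / √k)) := by
        rw [← ENNReal.ofReal_mul (by positivity), ← ENNReal.ofReal_add (by positivity)
          (by positivity), mul_right_comm, div_mul_eq_mul_div, mul_div_assoc, Real.sqrt_div_self',
          mul_assoc, one_div_mul_eq_div]
    _ ≤ ENNReal.ofReal ((46 + C : ℝ≥0) * (Y ^ 2 / √k)) := by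
        push_cast
        rw [add_mul]
        gcongr
        exact le_self_pow₀ hY two_ne_zero

end AveragedDensity

section VerticalMeasure

variable {ι : Type*} [Fintype ι] {k : ℕ} (B : Module.Basis ι ℂ (CuspForm 𝒮ℒ (k : ℤ))) (x : ℝ)

theorem averagedDensity_nonneg {y : ℝ} (hy : 0 < y) : 0 ≤ averagedDensity B x y := by
  unfold averagedDensity
  positivity

theorem continuousOn_averagedDensity : ContinuousOn (averagedDensity B x) (Ioi 0) := by
  refine continuousOn_const.mul (continuousOn_finsetSum _ fun i _ ↦
    (continuousOn_id.pow k).mul (ContinuousOn.pow (ContinuousOn.norm ?_) 2))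
  have hB := (UpperHalfPlane.mdifferentiable_iff.mp (B i).holo').continuousOn
  refine hB.comp (f := fun y : ℝ ↦ (x : ℂ) + (y : ℂ) * Complex.I) (by fun_prop) fun y hy ↦ ?_
  simpa using hy

variable {E : Type*} [NormedAddCommGroup E] [NormedSpace ℝ E]

theorem integral_multiplicativeMeasure (f : ℝ → E) :
    ∫ y, f y ∂multiplicativeMeasure = ∫ y in Ioi 0, y⁻¹ • f y := by
  rw [multiplicativeMeasure, integral_withDensity_eq_integral_toReal_smul₀
    (by fun_prop) (ae_of_all _ fun _ ↦ ENNReal.ofReal_lt_top)]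
  refine setIntegral_congr_fun measurableSet_Ioi fun y hy ↦ ?_
  simp only [one_div, ENNReal.toReal_ofReal (inv_pos.mpr hy).le]

theorem integral_averagedVerticalMeasure (f : ℝ → E) :
    ∫ y, f y ∂averagedVerticalMeasure B x =
      ∫ y in Ioi 0, (y⁻¹ * averagedDensity B x y) • f y := by
  have hmeas : AEMeasurable (fun y ↦ ENNReal.ofReal (averagedDensity B x y))
      multiplicativeMeasure :=
    (((continuousOn_averagedDensity B x).aemeasurable measurableSet_Ioi).ennreal_ofReal).mono_ac
      (withDensity_absolutelyContinuous _ _)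
  rw [averagedVerticalMeasure, integral_withDensity_eq_integral_toReal_smul₀ hmeas
    (ae_of_all _ fun _ ↦ ENNReal.ofReal_lt_top), integral_multiplicativeMeasure]
  refine setIntegral_congr_fun measurableSet_Ioi fun y hy ↦ ?_
  simp only [ENNReal.toReal_ofReal (averagedDensity_nonneg B x hy), smul_smul]

theorem norm_integral_smul_le_of_lintegral_le {α : Type*} [MeasurableSpace α] {μ : Measure α}
    {f : α → ℝ} {ψ : α → E} {M R : ℝ} (hM : 0 ≤ M) (hψ : ∀ a, ‖ψ a‖ ≤ M) (hR : 0 ≤ R)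
    (hf : ∫⁻ a, ENNReal.ofReal |f a| ∂μ ≤ ENNReal.ofReal R) :
    ‖∫ a, f a • ψ a ∂μ‖ ≤ M * R := by
  refine (norm_integral_le_lintegral_norm _).trans
    (ENNReal.toReal_le_of_le_ofReal (by positivity) ?_)
  calc ∫⁻ a, ENNReal.ofReal ‖f a • ψ a‖ ∂μ
      ≤ ∫⁻ a, ENNReal.ofReal M * ENNReal.ofReal |f a| ∂μ := by
        refine lintegral_mono fun a ↦ ?_
        rw [← ENNReal.ofReal_mul hM, norm_smul, Real.norm_eq_abs, mul_comm]
        gcongr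
        exact hψ a
    _ = ENNReal.ofReal M * ∫⁻ a, ENNReal.ofReal |f a| ∂μ :=
        lintegral_const_mul' _ _ ENNReal.ofReal_ne_top
    _ ≤ ENNReal.ofReal M * ENNReal.ofReal R := by gcongr
    _ = ENNReal.ofReal (M * R) := (ENNReal.ofReal_mul hM).symm

variable {ψ : ℝ → E} {a b M : ℝ}

theorem integrableOn_smul_of_support_subset_Ioo {f : ℝ → ℝ} (hf : ContinuousOn f (Ioi 0))
    (hψ : AEStronglyMeasurable ψ) (hM : ∀ y, ‖ψ y‖ ≤ M) (ha : 0 < a)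
    (hsupp : Function.support ψ ⊆ Ioo a b) : IntegrableOn (fun y ↦ f y • ψ y) (Ioi 0) := by
  have hf' : IntegrableOn f (Ioo a b) :=
    ((hf.mono fun y hy ↦ ha.trans_le hy.1).integrableOn_compact isCompact_Icc).mono_set
      Ioo_subset_Icc_self
  have hIoo : IntegrableOn (fun y ↦ f y • ψ y) (Ioo a b) :=
    hf'.smul_bdd M hψ.restrict (ae_of_all _ hM)
  exact ((integrableOn_iff_integrable_of_support_subset
    ((Function.support_smul_subset_right f ψ).trans hsupp)).mp hIoo).integrableOn

theorem integral_averagedVerticalMeasure_sub_smul (hψ : AEStronglyMeasurable ψ)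
    (hM : ∀ y, ‖ψ y‖ ≤ M) (ha : 0 < a) (hsupp : Function.support ψ ⊆ Ioo a b) (c : ℝ) :
    (∫ y, ψ y ∂averagedVerticalMeasure B x) - c • ∫ y, ψ y ∂multiplicativeMeasure =
      ∫ y in Ioo a b, (y⁻¹ * (averagedDensity B x y - c)) • ψ y := by
  have hinv : ContinuousOn (fun y : ℝ ↦ y⁻¹) (Ioi 0) :=
    continuousOn_inv₀.mono fun y hy ↦ ne_of_gt hy
  have hdensity : IntegrableOn (fun y ↦ (y⁻¹ * averagedDensity B x y) • ψ y) (Ioi 0) :=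
    integrableOn_smul_of_support_subset_Ioo (hinv.mul (continuousOn_averagedDensity B x))
      hψ hM ha hsupp
  have hconst : IntegrableOn (fun y ↦ (c * y⁻¹) • ψ y) (Ioi 0) :=
    integrableOn_smul_of_support_subset_Ioo (hinv.const_mul c) hψ hM ha hsupp
  calc (∫ y, ψ y ∂averagedVerticalMeasure B x) - c • ∫ y, ψ y ∂multiplicativeMeasure
      = (∫ y in Ioi 0, (y⁻¹ * averagedDensity B x y) • ψ y) -
          ∫ y in Ioi 0, (c * y⁻¹) • ψ y := by
        simp only [integral_averagedVerticalMeasure, integral_multiplicativeMeasure,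
          ← integral_smul, smul_smul]
    _ = ∫ y in Ioi 0, (y⁻¹ * (averagedDensity B x y - c)) • ψ y := by
        rw [← integral_sub hdensity hconst]
        simp only [← sub_smul, mul_sub, mul_comm c]
    _ = ∫ y in Ioo a b, (y⁻¹ * (averagedDensity B x y - c)) • ψ y := by
        refine setIntegral_eq_of_subset_of_forall_sdiff_eq_zero measurableSet_Ioi
          (fun y hy ↦ ha.trans hy.1) fun y hy ↦ ?_
        rw [Function.notMem_support.mp fun h ↦ hy.2 (hsupp h), smul_zero]

end VerticalMeasure

theorem sq_rpow_half_mul_rpow_neg_half_le {A k : ℝ} (hA : 2 ≤ A) (hk : 1 < k) :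
    (k ^ (1 / 2 : ℝ) * (17 * A * Real.log k) ^ (-(1 / 2) : ℝ)) ^ 2 ≤ k / (24 * Real.log k) := by
  have hlog : 0 < Real.log k := Real.log_pos hk
  have : 0 < A := by linarith
  have hAlog : 0 ≤ 17 * A * Real.log k := by positivity
  rw [Real.rpow_neg hAlog, ← Real.sqrt_eq_rpow, ← Real.sqrt_eq_rpow, mul_pow, inv_pow,
    Real.sq_sqrt (by linarith), Real.sq_sqrt hAlog, ← div_eq_mul_inv]
  gcongr
  linarith

theorem theorem1_general : ∃ C : ℝ, 0 < C ∧ ∀ (Y T : ℝ) (k : ℕ), 1 ≤ Y → 256 ≤ k → Even k →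
    T ^ 2 ≤ k / (24 * Real.log k) →
    ∀ (ι : Type*) [Fintype ι] (B : Module.Basis ι ℂ (CuspForm 𝒮ℒ (k : ℤ))),
      IsPeterssonOrthonormal B →
    ∀ (x : ℝ) (E : Type*) [NormedAddCommGroup E] [NormedSpace ℝ E] (ψ : ℝ → E),
      AEStronglyMeasurable ψ → BddAbove (range fun y ↦ ‖ψ y‖) →
      Function.support ψ ⊆ Ioo Y⁻¹ T →
      ‖(∫ y, ψ y ∂averagedVerticalMeasure B x) -
          (3 / Real.pi) • ∫ y, ψ y ∂multiplicativeMeasure‖ ≤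
        C * ((⨆ y, ‖ψ y‖) * Y ^ 2 * (k : ℝ) ^ (-(1 / 2) : ℝ)) := by
  obtain ⟨C, hC, hL1⟩ := exists_setLIntegral_averagedDensity_sub_le
  refine ⟨C, hC, fun Y T k hY hk heven hT ι _ B hB x E _ _ ψ hψ hbdd hsupp ↦ ?_⟩
  obtain ⟨m, rfl⟩ := heven.two_dvd
  rw [integral_averagedVerticalMeasure_sub_smul B x hψ (le_ciSup hbdd) (by positivity) hsupp]
  push_cast at hT
  refine (norm_integral_smul_le_of_lintegral_le (Real.iSup_nonneg fun y ↦ norm_nonneg _)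
    (le_ciSup hbdd) (by positivity) (hL1 m x Y T (by omega) hY hT ι B hB)).trans_eq ?_
  rw [Real.rpow_neg (by positivity), ← Real.sqrt_eq_rpow]
  push_cast
  ring

end

theorem theorem1 :
    ∃ (A₀ Y₀ C : ℝ) (k₀ : ℕ), 0 < A₀ ∧ 0 < Y₀ ∧ 0 < C ∧
      ∀ (A Y : ℝ) (k : ℕ), A₀ ≤ A → Y₀ ≤ Y → k₀ ≤ k → Even k →
      ∀ (ι : Type) [Fintype ι] (B : Module.Basis ι ℂ (CuspForm 𝒮ℒ (k : ℤ))),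
        IsPeterssonOrthonormal B →
      ∀ (x : ℝ) (ψ : ℝ → ℂ), ContDiff ℝ ∞ ψ → HasCompactSupport ψ →
        tsupport ψ ⊆ Set.Ioo Y⁻¹
          ((k : ℝ) ^ (1 / 2 : ℝ) * (17 * A * Real.log k) ^ (-(1 / 2) : ℝ)) →
        ‖(∫ y, ψ y ∂(averagedVerticalMeasure B x))
            - ((3 / Real.pi : ℝ) : ℂ) * ∫ y, ψ y ∂multiplicativeMeasure‖
          ≤ C * ((⨆ y, ‖ψ y‖) * Y ^ 2 * (k : ℝ) ^ (-(1 / 2) : ℝ)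
              * (Real.log k) ^ (1 / 2 : ℝ)) := by
  obtain ⟨C, hC, hbound⟩ := theorem1_general
  refine ⟨2, 1, C, 256, two_pos, one_pos, hC, fun A Y k hA hY hk heven ι _ B hB x ψ hψ hc hs ↦ ?_⟩
  have hk' : (256 : ℝ) ≤ k := by exact_mod_cast hk
  have hM : 0 ≤ ⨆ y, ‖ψ y‖ := Real.iSup_nonneg fun y ↦ norm_nonneg _
  refine (hbound Y _ k hY hk heven (sq_rpow_half_mul_rpow_neg_half_le hA (by linarith)) ι B hB x ℂ
    ψ hψ.continuous.aestronglyMeasurable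
    (hψ.continuous.norm.bddAbove_range_of_hasCompactSupport hc.norm)
    ((subset_tsupport ψ).trans hs)).trans ?_
  have hlog : 1 ≤ Real.log k ^ (1 / 2 : ℝ) :=
    Real.one_le_rpow (one_le_log_of_three_le (by linarith)) (by norm_num)
  exact mul_le_mul_of_nonneg_left (le_mul_of_one_le_right (by positivity) hlog) hC.le
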